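/- Let $\Phi(\xi,\mu)=\frac1{16}\xi^3-\frac38\xi\mu^2-\frac18\xi^2+\frac14\mu^2+\frac12\xi$. Fix $\psi\in C_c^\infty(\mathbb R)$ with $0\le\psi\le1$, $\psi=1$ on $(-100,100)$ and $\operatorname{supp}\psi\subset[-200,200]$, and let $\chi_1(\xi,\mu)=[1-\psi(\xi/\mu)]\,[1-\psi(\xi)]$ (with $\psi(\xi/\mu)$ replaced by $0$ when $\mu=0$). For $f\in L^2(\mathbb R^2)$ put $$W_1(t)f(x,y)=\int_{\mathbb R^2}e^{ix\xi+iy\mu+it\Phi(\xi,\mu)}\,\widehat f(\xi,\mu)\,\chi_1(\xi,\mu)\,d\xi\,d\mu,\qquad \widehat f(\xi,\mu)=\int_{\mathbb R^2} e^{-i(x\xi+y\mu)}f(x,y)\,dx\,dy,$$ understood in the sense of the $L^2$ Fourier transform. Let $\langle\nabla\rangle^s$ be the Fourier multiplier operator with symbol $(1+|\xi|+|\mu|)^s$, and let $H^s(\mathbb R^2)$ have the norm $\|\langle\nabla\rangle^s f\|_{L^2(\mathbb R^2)}$. Let $(\alpha_n)_{n\ge0}$ be smooth functions $\mathbb R\to\mathbb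 C$ with $\operatorname{supp}\alpha_n\subset\{2^{n-1}\le|\xi|\le2^{n+1}\}$ for $n\ge1$, $\operatorname{supp}\alpha_0\subset\{|\xi|\le2\}$, and $\sup_{n\ge 0}\,2^{nm}\|\alpha_n^{(m)}\|_{L^\infty}<\infty$ for every $m\ge0$ (for example $\alpha_n(\xi)=\beta(2^{-n}\xi)$ for a fixed profile $\beta\in C_c^\infty$ supported in $\{\frac12\le|\xi|\le2\}$), and let $$I_{k,j}(t,x,y)=\int_{\mathbb R^2}e^{ix\xi+iy\mu+it\Phi(\xi,\mu)}\,\alpha_k(\xi)\,\alpha_j(\mu)\,d\mu\,d\xi .$$ For a measurable $u=u(t,x,y)$ and a time interval $J$ write $$\|u\|_{L^4_xL^\infty_{t\in J,y}}=\Big(\int_{\mathbb R}\big(\operatorname*{ess\,sup}_{t\in J,\,y\in\mathbb R}|u(t,x,y)|\big)^4dx\Big)^{1/4}.$$ A family $(U(t))_{t\in J}$ in $L^2(\mathbb R^2)$ is identified with a jointly measurable function $u(t,x,y)$ such that $u(t,\cdot,\cdot)=U(t)$ almost everywhere, for almost every $t\in J$. Then the following hold. 1. There is a constant $C$, depending only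 on the family $(\alpha_n)$, such that for all integers $k\ge7$ and $0\le j<k-4$, all $t,y\in\mathbb R$ and all $x\neq0$, $$|I_{k,j}(t,x,y)|\le C\,|x|^{-1/2}\,2^{j+k/2}.$$ 2. For every $s>3/4$ there is a constant $C$, depending only on $s$ and $\psi$, such that for every $u_0\in H^s(\mathbb R^2)$ the family $(W_1(t)u_0)_{t\ge0}$ is represented by a jointly measurable function, and every such function satisfies $$\|W_1(t)u_0\|_{L^4_xL^\infty_{t\in[0,\infty),y}}\le C\,\|\langle\nabla\rangle^su_0\|_{L^2(\mathbb R^2)}.$$ 3. For every $s>3/4$ there is a constant $C$, depending only on $s$ and $\psi$, such that for every $T>0$ and every $F\in L^1([0,T];H^s(\mathbb R^2))$ the integrals $\int_0^tW_1(t-t')F(t')\,dt'$, $t\in[0,T]$, exist as Bochner integrals in $L^2(\mathbb R^2)$, are represented by a jointly measurable function of $(t,x,y)$, and every such function satisfies $$\Big\|\int_0^tW_1(t-t')F(t')\,dt'\Big\|_{L^4_xL^\infty_{t\in[0,T],y}}\le C\int_0^T\|\langle\nabla\rangle^sF(t)\|_{L^2(\mathbb R^2)}\,dt.$$ -/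

import Mathlib

open MeasureTheory FourierTransform
open scoped ENNReal NNReal ContDiff

/-- The plane `ℝ²`, with coordinates `p 0 = x`, `p 1 = y`. -/
abbrev Plane : Type := EuclideanSpace ℝ (Fin 2)

/-- The space `L²(ℝ²)` of complex-valued functions. -/
abbrev L2Plane : Type := Lp ℂ 2 (volume : Measure Plane)

/-- The symbol `Φ(ξ, μ)` of the linear Dysthe equation. -/
noncomputable def dysthePhase (ξ μ : ℝ) : ℝ :=
  1 / 16 * ξ ^ 3 - 3 / 8 * ξ * μ ^ 2 - 1 / 8 * ξ ^ 2 + 1 / 4 * μ ^ 2 + 1 / 2 * ξ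

/-- A smooth cut-off `ψ` with `0 ≤ ψ ≤ 1`, `ψ = 1` on `B(0,100)` and `supp ψ ⊆ B(0,200)`. -/
structure BasicCutoff where
  ψ : ℝ → ℝ
  smooth : ContDiff ℝ ∞ ψ
  nonneg : ∀ r, 0 ≤ ψ r
  le_one : ∀ r, ψ r ≤ 1
  eq_one : ∀ r, |r| < 100 → ψ r = 1
  supp : tsupport ψ ⊆ Metric.closedBall 0 200

/-- `χ₁(ξ, μ) = (1 - ψ(ξ/μ)) (1 - ψ(ξ))`, where `ψ(ξ/μ)` is read as `ψ(±∞) = 0` when `μ = 0`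
(where `ξ = 0` as well, the second factor vanishes). -/
noncomputable def BasicCutoff.chi1 (c : BasicCutoff) (ξ μ : ℝ) : ℝ :=
  if μ = 0 then 1 - c.ψ ξ else (1 - c.ψ (ξ / μ)) * (1 - c.ψ ξ)

/-- The Fourier symbol `exp(i t Φ(ξ, μ)) χ₁(ξ, μ)` of `W₁(t)`. -/
noncomputable def BasicCutoff.symbol1 (c : BasicCutoff) (t ξ μ : ℝ) : ℂ :=
  Complex.exp (Complex.I * ((t * dysthePhase ξ μ : ℝ) : ℂ)) * (c.chi1 ξ μ : ℂ)

theorem BasicCutoff.measurable_symbol1 (c : BasicCutoff) (t : ℝ) :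
    Measurable (fun p : Plane => c.symbol1 t (2 * Real.pi * p 0) (2 * Real.pi * p 1)) := by
  have h0 : Measurable (fun p : Plane => 2 * Real.pi * p 0) := by fun_prop
  have h1 : Measurable (fun p : Plane => 2 * Real.pi * p 1) := by fun_prop
  have hψ : Measurable c.ψ := c.smooth.continuous.measurable
  unfold BasicCutoff.symbol1 BasicCutoff.chi1 dysthePhase
  refine Measurable.mul (by fun_prop) (Complex.measurable_ofReal.comp ?_)
  refine Measurable.ite (h1 (measurableSet_singleton 0)) ?_ ?_
  · exact (hψ.comp h0).const_sub 1
  · exact ((hψ.comp (h0.div h1)).const_sub 1).mul ((hψ.comp h0).const_sub 1)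

theorem BasicCutoff.norm_symbol1_le (c : BasicCutoff) (t ξ μ : ℝ) :
    ‖c.symbol1 t ξ μ‖ ≤ 1 := by
  have h : ∀ r, 0 ≤ 1 - c.ψ r ∧ 1 - c.ψ r ≤ 1 := fun r =>
    ⟨by linarith [c.le_one r], by linarith [c.nonneg r]⟩
  have hχ : |c.chi1 ξ μ| ≤ 1 := by
    unfold BasicCutoff.chi1
    split_ifs
    · rw [abs_of_nonneg (h ξ).1]; exact (h ξ).2
    · rw [abs_of_nonneg (mul_nonneg (h _).1 (h _).1)]
      exact mul_le_one₀ (h _).2 (h _).1 (h _).2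
  unfold BasicCutoff.symbol1
  rw [norm_mul, mul_comm Complex.I, Complex.norm_exp_ofReal_mul_I, one_mul, Complex.norm_real]
  exact hχ

theorem BasicCutoff.memLp_symbol1_mul (c : BasicCutoff) (t : ℝ) (f : L2Plane) :
    MemLp (fun p : Plane =>
      c.symbol1 t (2 * Real.pi * p 0) (2 * Real.pi * p 1) * (𝓕 f : L2Plane) p) 2 volume := by
  refine (Lp.memLp (𝓕 f : L2Plane)).of_le
    ((c.measurable_symbol1 t).aestronglyMeasurable.mul (Lp.aestronglyMeasurable _)) ?_
  refine Filter.Eventually.of_forall fun p => ?_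
  rw [norm_mul]
  exact mul_le_of_le_one_left (norm_nonneg _) (c.norm_symbol1_le _ _ _)

/-- The operator
`W₁(t) f (x,y) = ∫ exp(i x ξ + i y μ + i t Φ(ξ,μ)) χ₁(ξ,μ) f̂(ξ,μ) dξ dμ` on `L²(ℝ²)`, where
`f̂(ξ,μ) = ∫ exp(-i (x ξ + y μ)) f(x,y) dx dy`.
In terms of the unitary transform `𝓕 f (a) = ∫ exp(-2 π i ⟨a, p⟩) f(p) dp` on `L²`, the
substitution `(ξ,μ) = 2 π a` gives `f̂(2 π a) = 𝓕 f (a)` and `dξ dμ = (2 π)² da`. -/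
noncomputable def BasicCutoff.W1 (c : BasicCutoff) (t : ℝ) (f : L2Plane) : L2Plane :=
  (((2 * Real.pi) ^ 2 : ℝ) : ℂ) • (𝓕⁻ ((c.memLp_symbol1_mul t f).toLp _ : L2Plane) : L2Plane)

/-- The norm `‖⟨∇⟩^s f‖_{L²(ℝ²)}` (possibly `∞`), where `⟨∇⟩^s` is the Fourier multiplier with
symbol `(1 + |ξ| + |μ|)^s`; computed on the Fourier side, where `(ξ, μ) = 2 π a`. -/
noncomputable def sobolevNorm (s : ℝ) (f : L2Plane) : ℝ≥0∞ :=
  eLpNorm (fun a : Plane =>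
    (((1 + |2 * Real.pi * a 0| + |2 * Real.pi * a 1|) ^ s : ℝ) : ℂ) * (𝓕 f : L2Plane) a) 2 volume

/-- The lateral norm `‖u‖_{L^p_x L^q_{t,y}}` of `u = u(t, x, y)`, with `t` in the set `J`. -/
noncomputable def lateralNorm (p q : ℝ≥0∞) (J : Set ℝ) (u : ℝ → ℝ → ℝ → ℂ) : ℝ≥0∞ :=
  eLpNorm (fun x : ℝ =>
    eLpNorm (fun z : ℝ × ℝ => u z.1 x z.2) q ((volume.restrict J).prod volume)) p volume

/-- `u = u(t, x, y)` is a jointly measurable function which represents, for almost every time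
`t ∈ J`, the element `U t` of `L²(ℝ²)`. -/
def Represents (J : Set ℝ) (U : ℝ → L2Plane) (u : ℝ → ℝ → ℝ → ℂ) : Prop :=
  Measurable (fun q : ℝ × ℝ × ℝ => u q.1 q.2.1 q.2.2) ∧
    ∀ᵐ t ∂(volume.restrict J), (fun p : Plane => u t (p 0) (p 1)) =ᵐ[volume] U t

/-- A dyadic family of smooth cut-offs: `α n` lives at frequencies of size `2^n` (of size at
most `2` for `n = 0`), with the derivative bounds of the rescalings `ξ ↦ β(ξ / 2^n)` of a fixed
profile. Both signs of the frequency are allowed. -/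
structure IsDyadicFamily (α : ℕ → ℝ → ℂ) : Prop where
  smooth : ∀ n, ContDiff ℝ ∞ (α n)
  supp_zero : tsupport (α 0) ⊆ {ξ | |ξ| ≤ 2}
  supp_succ : ∀ n : ℕ, tsupport (α (n + 1)) ⊆ {ξ | (2 : ℝ) ^ n ≤ |ξ| ∧ |ξ| ≤ (2 : ℝ) ^ (n + 2)}
  deriv_bound : ∀ m : ℕ, ∃ C : ℝ, ∀ (n : ℕ) (ξ : ℝ),
    ‖iteratedDeriv m (α n) ξ‖ ≤ C / (2 : ℝ) ^ (n * m)

/-- The kernel `I_{k,j}(t,x,y)`. -/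
noncomputable def dyadicKernel (α : ℕ → ℝ → ℂ) (k j : ℕ) (t x y : ℝ) : ℂ :=
  ∫ p : ℝ × ℝ, Complex.exp (Complex.I * ((p.1 * x + p.2 * y + t * dysthePhase p.1 p.2 : ℝ) : ℂ)) *
    α k p.1 * α j p.2

/-!
Both linear estimates come from dispersion in the variable `ξ` alone. On the support of `χ₁` one has
`|ξ| ≥ 100` and `100 |μ| ≤ |ξ|`; there `∂_ξ Φ` has size at most a constant times `ξ²`, and `∂_ξ² Φ =
3 ξ / 8 - 1 / 4` has size comparable to `|ξ|`. For fixed `μ` and `|ξ|` of size `L`, the van der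
Corput lemma then bounds `∫ exp(i (x ξ + t Φ(ξ, μ))) dξ` by a multiple of `(L / |x|)^{1/2}`, uniformly in
`t` (`Dysthe.norm_integral_exp_dysthePhase_le`): if `|x| ≥ 8 |t| L²` the phase is not stationary,
and otherwise `|t|` is so large that the second derivative gives the same bound. Integrating
trivially in `μ` proves the kernel estimate (`Dysthe.exists_norm_dyadicKernel_le`).

For the propagator, the support of `χ₁` is covered by the disjoint cells `Dysthe.cell k`, in which
`L ≤ |ξ| < 2 L` and `|μ| ≤ L / 8` with `L = 2^(k+6)`. The cells have sharp edges: the estimate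
of van der Corput holds on any interval, and therefore no smooth partition of unity is needed. The kernel of a
cell is at most a multiple of `L^{3/2} |x|^{-1/2}` for all `t` and `y`, so the `T T*` argument and
the Hardy–Littlewood–Sobolev inequality `L^{4/3} → L^4` bound the maximal function over `t` and `y`
of the cell in `L^4_x` by a multiple of `L^{3/4}` times the `L²` norm
(`Dysthe.lintegral_cellMax_pow_le`). The supremum is handled by linearisation: it is a supremum over
a countable set of parameters, and a measurable choice of the best among the first `N` of them is
inserted before `T T*` is applied (`Dysthe.lintegral_iSup_enorm_integral_mul_pow_le`). For `s > 3/4`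
the bounds for the cells are summable against the norm of `H^s`.

A function with frequencies in the cells is almost everywhere at most the sum of its pieces in
absolute value (`Dysthe.ae_enorm_le_tsum_cellEval`). This gives the homogeneous estimate. In the
inhomogeneous one, each piece of the Duhamel integral is at most the integral over `t'` of the
maximal functions of `F(t')`, because these are already suprema over all times; Minkowski's
inequality in `L^4_x` concludes. In both cases the majorant depends on `x` only, which passes to the
essential supremum of any jointly measurable representative by Fubini
(`Dysthe.lateralNorm_le_of_ae_le`). Such representatives exist for every strongly measurable family
in `L²` (`Dysthe.exists_represents`).
-/

namespace Dysthe

/-! ### Van der Corput estimates -/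

section VanDerCorput

variable {φ φ' φ'' : ℝ → ℝ} {a b lam : ℝ}

lemma norm_exp_I_mul_ofReal (r : ℝ) : ‖Complex.exp (Complex.I * (r : ℂ))‖ = 1 := by
  rw [mul_comm, Complex.norm_exp_ofReal_mul_I]

/-- First-derivative van der Corput estimate for a phase with monotone derivative. -/
lemma norm_integral_exp_le_of_le_abs_deriv (hab : a ≤ b) (hlam : 0 < lam)
    (h1 : ∀ x, HasDerivAt φ (φ' x) x) (h2 : ∀ x, HasDerivAt φ' (φ'' x) x)
    (hc : Continuous φ'') (hpos : ∀ x ∈ Set.Icc a b, 0 ≤ φ'' x)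
    (hl : ∀ x ∈ Set.Icc a b, lam ≤ |φ' x|) :
    ‖∫ x in a..b, Complex.exp (Complex.I * (φ x : ℂ))‖ ≤ 4 / lam := by
  have hφ : Continuous φ := continuous_iff_continuousAt.2 fun x => (h1 x).continuousAt
  have hφ' : Continuous φ' := continuous_iff_continuousAt.2 fun x => (h2 x).continuousAt
  have hne : ∀ x ∈ Set.Icc a b, φ' x ≠ 0 := fun x hx h0 => by
    have := hl x hx
    rw [h0, abs_zero] at this
    linarith
  set e : ℝ → ℂ := fun x => Complex.exp (Complex.I * (φ x : ℂ)) with he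
  have hec : Continuous e := by fun_prop
  have hue : Set.uIcc a b = Set.Icc a b := Set.uIcc_of_le hab
  -- the amplitude `φ'' / φ' ^ 2` left over after one integration by parts
  have hq : ContinuousOn (fun x => φ'' x / φ' x ^ 2) (Set.Icc a b) :=
    hc.continuousOn.div (hφ'.pow 2).continuousOn fun x hx => pow_ne_zero 2 (hne x hx)
  have hqi : IntervalIntegrable (fun x => φ'' x / φ' x ^ 2) volume a b :=
    ContinuousOn.intervalIntegrable (hue ▸ hq)
  have hei : IntervalIntegrable e volume a b := hec.intervalIntegrable _ _
  have hri : IntervalIntegrable (fun x => e x * Complex.I * ((φ'' x / φ' x ^ 2 : ℝ) : ℂ))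
      volume a b := by
    refine ContinuousOn.intervalIntegrable (hue ▸ ?_)
    exact (hec.mul continuous_const).continuousOn.mul
      (Complex.continuous_ofReal.comp_continuousOn hq)
  have hF : ∀ x ∈ Set.uIcc a b, HasDerivAt (fun x => e x * (-Complex.I) * ((φ' x : ℂ))⁻¹)
      (e x + e x * Complex.I * ((φ'' x / φ' x ^ 2 : ℝ) : ℂ)) x := by
    intro x hx
    have hx0 : (φ' x : ℂ) ≠ 0 := by exact_mod_cast hne x (hue ▸ hx)
    have d1 : HasDerivAt e (e x * (Complex.I * (φ' x : ℂ))) x :=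
      (((h1 x).ofReal_comp).const_mul Complex.I).cexp
    have d2 : HasDerivAt (fun x => ((φ' x : ℂ))⁻¹) (-(φ'' x : ℂ) / (φ' x : ℂ) ^ 2) x :=
      ((h2 x).ofReal_comp).inv hx0
    convert! (d1.mul_const (-Complex.I)).mul d2 using 1
    push_cast
    field_simp
    linear_combination (e x * (φ' x : ℂ) ^ 2) * Complex.I_sq
  have hFI := intervalIntegral.integral_eq_sub_of_hasDerivAt hF (hei.add hri)
  rw [intervalIntegral.integral_add hei hri] at hFI
  have hinv : ∀ x ∈ Set.Icc a b, |(φ' x)⁻¹| ≤ 1 / lam := fun x hx => by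
    rw [abs_inv, one_div]
    exact inv_anti₀ hlam (hl x hx)
  have ha : a ∈ Set.Icc a b := ⟨le_rfl, hab⟩
  have hb : b ∈ Set.Icc a b := ⟨hab, le_rfl⟩
  have hbd : ∀ x ∈ Set.Icc a b, ‖e x * (-Complex.I) * ((φ' x : ℂ))⁻¹‖ ≤ 1 / lam := by
    intro x hx
    rw [norm_mul, norm_mul, norm_neg, Complex.norm_I, he, norm_exp_I_mul_ofReal, one_mul, one_mul,
      ← Complex.ofReal_inv, Complex.norm_real]
    exact hinv x hx
  have hrem : ‖∫ x in a..b, e x * Complex.I * ((φ'' x / φ' x ^ 2 : ℝ) : ℂ)‖ ≤ 2 / lam := by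
    have hd : ∀ x ∈ Set.uIcc a b, HasDerivAt (fun x => -(φ' x)⁻¹) (φ'' x / φ' x ^ 2) x := by
      intro x hx
      convert! ((h2 x).inv (hne x (hue ▸ hx))).neg using 1
      ring
    calc _ ≤ ∫ x in a..b, φ'' x / φ' x ^ 2 := by
          refine intervalIntegral.norm_integral_le_of_norm_le hab ?_ hqi
          refine Filter.Eventually.of_forall fun x hx => ?_
          rw [norm_mul, norm_mul, Complex.norm_I, he, norm_exp_I_mul_ofReal, one_mul, one_mul,
            Complex.norm_real, Real.norm_eq_abs, abs_of_nonneg]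
          exact div_nonneg (hpos x ⟨hx.1.le, hx.2⟩) (sq_nonneg _)
      _ = -(φ' b)⁻¹ - -(φ' a)⁻¹ := intervalIntegral.integral_eq_sub_of_hasDerivAt hd hqi
      _ ≤ 1 / lam + 1 / lam := by
          have h3 := abs_le.1 (hinv a ha)
          have h4 := abs_le.1 (hinv b hb)
          linarith
      _ = 2 / lam := by ring
  have hmain : (∫ x in a..b, e x) = (e b * (-Complex.I) * ((φ' b : ℂ))⁻¹ -
      e a * (-Complex.I) * ((φ' a : ℂ))⁻¹) -
      ∫ x in a..b, e x * Complex.I * ((φ'' x / φ' x ^ 2 : ℝ) : ℂ) := by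
    rw [← hFI]; ring
  rw [hmain]
  refine (norm_sub_le _ _).trans ?_
  have h5 := (norm_sub_le (e b * (-Complex.I) * ((φ' b : ℂ))⁻¹)
    (e a * (-Complex.I) * ((φ' a : ℂ))⁻¹)).trans (add_le_add (hbd b hb) (hbd a ha))
  calc _ ≤ (1 / lam + 1 / lam) + 2 / lam := add_le_add h5 hrem
    _ = 4 / lam := by ring

lemma norm_integral_exp_le_length (hab : a ≤ b) (φ : ℝ → ℝ) :
    ‖∫ x in a..b, Complex.exp (Complex.I * (φ x : ℂ))‖ ≤ b - a := by
  have := intervalIntegral.norm_integral_le_of_norm_le_const (a := a) (b := b) (C := 1)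
    (f := fun x => Complex.exp (Complex.I * (φ x : ℂ))) fun x _ => (norm_exp_I_mul_ofReal _).le
  rwa [one_mul, abs_of_nonneg (by linarith)] at this

/-- Second-derivative van der Corput estimate for a convex phase: outside an interval of length
`2 / √λ` around the critical point, the derivative is at least `√λ`. -/
lemma norm_integral_exp_le_of_le_deriv2 (hab : a ≤ b) (hlam : 0 < lam)
    (h1 : ∀ x, HasDerivAt φ (φ' x) x) (h2 : ∀ x, HasDerivAt φ' (φ'' x) x)
    (hc : Continuous φ'') (hl : ∀ x ∈ Set.Icc a b, lam ≤ φ'' x) :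
    ‖∫ x in a..b, Complex.exp (Complex.I * (φ x : ℂ))‖ ≤ 10 / √lam := by
  have hφ : Continuous φ := continuous_iff_continuousAt.2 fun x => (h1 x).continuousAt
  have hφ' : Continuous φ' := continuous_iff_continuousAt.2 fun x => (h2 x).continuousAt
  have hmvt : ∀ x ∈ Set.Icc a b, ∀ y ∈ Set.Icc a b, x ≤ y → lam * (y - x) ≤ φ' y - φ' x := by
    intro x hx y hy hxy
    refine (convex_Icc a b).mul_sub_le_image_sub_of_le_deriv hφ'.continuousOn
      (fun z _ => (h2 z).differentiableAt.differentiableWithinAt) (fun z hz => ?_) x hx y hy hxy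
    rw [(h2 z).deriv]
    exact hl z (interior_subset hz)
  obtain ⟨c, hcm, hcr, hcl⟩ : ∃ c ∈ Set.Icc a b,
      (∀ x ∈ Set.Icc a b, c < x → lam * (x - c) ≤ φ' x) ∧
      (∀ x ∈ Set.Icc a b, x < c → φ' x ≤ lam * (x - c)) := by
    have ha : a ∈ Set.Icc a b := ⟨le_rfl, hab⟩
    have hb : b ∈ Set.Icc a b := ⟨hab, le_rfl⟩
    rcases le_or_gt 0 (φ' a) with h | h
    · refine ⟨a, ha, fun x hx hxa => ?_, fun x hx hxa => absurd hx.1 (not_le.2 hxa)⟩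
      linarith [hmvt a ha x hx hxa.le]
    rcases le_or_gt (φ' b) 0 with h' | h'
    · refine ⟨b, hb, fun x hx hxa => absurd hx.2 (not_le.2 hxa), fun x hx hxa => ?_⟩
      linarith [hmvt x hx b hb hxa.le]
    · obtain ⟨c, hc, hc0⟩ := intermediate_value_Icc hab hφ'.continuousOn ⟨h.le, h'.le⟩
      refine ⟨c, hc, fun x hx hx' => ?_, fun x hx hx' => ?_⟩
      · linarith [hmvt c hc x hx hx'.le]
      · linarith [hmvt x hx c hc hx'.le]
  set e : ℝ → ℂ := fun x => Complex.exp (Complex.I * (φ x : ℂ)) with he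
  have hec : Continuous e := by fun_prop
  have hs : 0 < √lam := Real.sqrt_pos.2 hlam
  have hss : √lam * √lam = lam := Real.mul_self_sqrt hlam.le
  have hδ : lam * (1 / √lam) = √lam := by rw [mul_one_div, div_eq_iff hs.ne', hss]
  have hδ0 : 0 < 1 / √lam := by positivity
  set δ := 1 / √lam with hδd
  have hl1 : ‖∫ x in a..max a (c - δ), e x‖ ≤ 4 / √lam := by
    rcases le_or_gt (c - δ) a with h | h
    · rw [max_eq_left h, intervalIntegral.integral_same, norm_zero]; positivity
    · rw [max_eq_right h.le]
      refine norm_integral_exp_le_of_le_abs_deriv h.le hs h1 h2 hc (fun x hx => ?_) fun x hx => ?_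
      · exact hlam.le.trans (hl x ⟨hx.1, by linarith [hx.2, hcm.2]⟩)
      · have h3 := hcl x ⟨hx.1, by linarith [hx.2, hcm.2]⟩ (by linarith [hx.2])
        have h4 : lam * (x - c) ≤ lam * (-δ) := by
          apply mul_le_mul_of_nonneg_left _ hlam.le; linarith [hx.2]
        rw [abs_of_nonpos (by nlinarith)]
        nlinarith
  have hl3 : ‖∫ x in min b (c + δ)..b, e x‖ ≤ 4 / √lam := by
    rcases le_or_gt b (c + δ) with h | h
    · rw [min_eq_left h, intervalIntegral.integral_same, norm_zero]; positivity
    · rw [min_eq_right h.le]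
      refine norm_integral_exp_le_of_le_abs_deriv h.le hs h1 h2 hc (fun x hx => ?_) fun x hx => ?_
      · exact hlam.le.trans (hl x ⟨by linarith [hx.1, hcm.1], hx.2⟩)
      · have h3 := hcr x ⟨by linarith [hx.1, hcm.1], hx.2⟩ (by linarith [hx.1])
        have h4 : lam * δ ≤ lam * (x - c) := by
          apply mul_le_mul_of_nonneg_left _ hlam.le; linarith [hx.1]
        rw [abs_of_nonneg (by nlinarith)]
        nlinarith
  have hl2 : ‖∫ x in max a (c - δ)..min b (c + δ), e x‖ ≤ 2 / √lam := by
    have h5 : max a (c - δ) ≤ c := max_le hcm.1 (by linarith)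
    have h6 : c ≤ min b (c + δ) := le_min hcm.2 (by linarith)
    refine (norm_integral_exp_le_length (h5.trans h6) φ).trans ?_
    have h7 : c - δ ≤ max a (c - δ) := le_max_right _ _
    have h8 : min b (c + δ) ≤ c + δ := min_le_right _ _
    calc _ ≤ 2 * δ := by linarith
      _ = 2 / √lam := by rw [hδd]; ring
  rw [← intervalIntegral.integral_add_adjacent_intervals (hec.intervalIntegrable a (max a (c - δ)))
    (hec.intervalIntegrable _ b), ← intervalIntegral.integral_add_adjacent_intervals
    (hec.intervalIntegrable (max a (c - δ)) (min b (c + δ))) (hec.intervalIntegrable _ b)]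
  refine (norm_add_le _ _).trans ((add_le_add hl1 ((norm_add_le _ _).trans
    (add_le_add hl2 hl3))).trans (le_of_eq ?_))
  ring

lemma norm_integral_exp_neg (hab : a ≤ b) (φ : ℝ → ℝ) :
    ‖∫ x in a..b, Complex.exp (Complex.I * ((-φ x : ℝ) : ℂ))‖ =
      ‖∫ x in a..b, Complex.exp (Complex.I * (φ x : ℂ))‖ := by
  rw [← RCLike.norm_conj, intervalIntegral.integral_of_le hab, intervalIntegral.integral_of_le hab,
    ← integral_conj]
  congr 2
  ext x
  rw [← Complex.exp_conj]
  simp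

end VanDerCorput

/-! ### Oscillatory integrals with the Dysthe phase -/

/-- Oscillation in `ξ` at frequencies `|ξ| ∼ L`. If `|x| ≥ 8 |t| L²`, the phase has derivative at
least `|x| / 2`; otherwise its second derivative `t (3 ξ / 8 - 1 / 4)` has size at least
`|x| / (32 L)`. -/
lemma norm_integral_exp_dysthePhase_le {L μ a b : ℝ} (t x : ℝ) (hL : 64 ≤ L) (hμ : |μ| ≤ L / 8)
    (hab : a ≤ b) (hI : (L ≤ a ∧ b ≤ 4 * L) ∨ (-(4 * L) ≤ a ∧ b ≤ -L)) (hx : x ≠ 0) :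
    ‖∫ ξ in a..b, Complex.exp (Complex.I * ((ξ * x + t * dysthePhase ξ μ : ℝ) : ℂ))‖ ≤
      60 * √(L / |x|) := by
  -- complex conjugation changes the signs of `t` and `x`; for `0 ≤ t * a` the phase is convex
  wlog ht : 0 ≤ t * a generalizing t x
  · rw [← norm_integral_exp_neg hab]
    have := this (-t) (-x) (by simpa using hx) (by nlinarith)
    rw [abs_neg] at this
    convert this using 6
    ring_nf
  have h1 : ∀ ξ, HasDerivAt (fun ξ => ξ * x + t * dysthePhase ξ μ)
      (x + t * (3 / 16 * ξ ^ 2 - 3 / 8 * μ ^ 2 - 1 / 4 * ξ + 1 / 2)) ξ := by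
    intro ξ
    unfold dysthePhase
    have e1 := (((((hasDerivAt_pow 3 ξ).const_mul (1 / 16 : ℝ)).sub
      (((hasDerivAt_id ξ).const_mul (3 / 8 : ℝ)).mul_const (μ ^ 2))).sub
      ((hasDerivAt_pow 2 ξ).const_mul (1 / 8 : ℝ))).add_const (1 / 4 * μ ^ 2)).add
      ((hasDerivAt_id ξ).const_mul (1 / 2 : ℝ))
    convert! ((hasDerivAt_id ξ).mul_const x).add (e1.const_mul t) using 1
    push_cast
    ring
  have h2 : ∀ ξ, HasDerivAt (fun ξ => x + t * (3 / 16 * ξ ^ 2 - 3 / 8 * μ ^ 2 - 1 / 4 * ξ + 1 / 2))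
      (t * (3 / 8 * ξ - 1 / 4)) ξ := by
    intro ξ
    have e1 := (((((hasDerivAt_pow 2 ξ).const_mul (3 / 16 : ℝ)).sub_const (3 / 8 * μ ^ 2)).sub
      ((hasDerivAt_id ξ).const_mul (1 / 4 : ℝ))).add_const (1 / 2)).const_mul t
    convert! e1.const_add x using 1
    push_cast
    ring
  have hc : Continuous fun ξ : ℝ => t * (3 / 8 * ξ - 1 / 4) := by fun_prop
  have hx0 : 0 < |x| := abs_pos.2 hx
  have hd2 : ∀ ξ ∈ Set.Icc a b, |t| * (L / 4) ≤ t * (3 / 8 * ξ - 1 / 4) := by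
    intro ξ hξ
    rcases hI with ⟨h3, h4⟩ | ⟨h3, h4⟩
    · have ht0 : 0 ≤ t := nonneg_of_mul_nonneg_left ht (by linarith)
      rw [abs_of_nonneg ht0]
      exact mul_le_mul_of_nonneg_left (by linarith [hξ.1]) ht0
    · have ht0 : t ≤ 0 := by
        by_contra h
        nlinarith [not_le.1 h]
      rw [abs_of_nonpos ht0]
      have : (-t) * (L / 4) ≤ (-t) * -(3 / 8 * ξ - 1 / 4) :=
        mul_le_mul_of_nonneg_left (by linarith [hξ.2]) (by linarith)
      linarith
  rcases le_or_gt (8 * |t| * L ^ 2) |x| with hcase | hcase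
  · have hlow : ∀ ξ ∈ Set.Icc a b,
        |x| / 2 ≤ |x + t * (3 / 16 * ξ ^ 2 - 3 / 8 * μ ^ 2 - 1 / 4 * ξ + 1 / 2)| := by
      intro ξ hξ
      have hξ' : |ξ| ≤ 4 * L := by
        rw [abs_le]
        rcases hI with ⟨h3, h4⟩ | ⟨h3, h4⟩ <;> constructor <;> linarith [hξ.1, hξ.2]
      have e1 : ξ ^ 2 ≤ 16 * L ^ 2 := by
        rw [← sq_abs]; nlinarith [abs_nonneg ξ]
      have e2 : μ ^ 2 ≤ L ^ 2 := by
        rw [← sq_abs]; nlinarith [abs_nonneg μ]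
      have e3 := abs_le.1 hξ'
      have e4 : |3 / 16 * ξ ^ 2 - 3 / 8 * μ ^ 2 - 1 / 4 * ξ + 1 / 2| ≤ 4 * L ^ 2 := by
        rw [abs_le]
        constructor <;> nlinarith [sq_nonneg ξ, sq_nonneg μ]
      have e5 : |t * (3 / 16 * ξ ^ 2 - 3 / 8 * μ ^ 2 - 1 / 4 * ξ + 1 / 2)| ≤ |x| / 2 := by
        rw [abs_mul]
        nlinarith [mul_le_mul_of_nonneg_left e4 (abs_nonneg t)]
      have e6 := abs_sub_abs_le_abs_sub x
        (-(t * (3 / 16 * ξ ^ 2 - 3 / 8 * μ ^ 2 - 1 / 4 * ξ + 1 / 2)))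
      rw [abs_neg, sub_neg_eq_add] at e6
      linarith
    have b1 := norm_integral_exp_le_of_le_abs_deriv hab (by positivity : 0 < |x| / 2) h1 h2 hc
      (fun ξ hξ => le_trans (by positivity) (hd2 ξ hξ)) hlow
    have b2 : b - a ≤ 3 * L := by rcases hI with ⟨h3, h4⟩ | ⟨h3, h4⟩ <;> linarith
    have b3 := (norm_integral_exp_le_length hab
      (fun ξ => ξ * x + t * dysthePhase ξ μ)).trans b2
    set N := ‖∫ ξ in a..b, Complex.exp (Complex.I * ((ξ * x + t * dysthePhase ξ μ : ℝ) : ℂ))‖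
    have hN : 0 ≤ N := norm_nonneg _
    have b4 : N ^ 2 ≤ 60 ^ 2 * (L / |x|) := by
      calc N ^ 2 = N * N := sq N
        _ ≤ (3 * L) * (4 / (|x| / 2)) := mul_le_mul b3 b1 hN (by linarith)
        _ = 24 * (L / |x|) := by field_simp; norm_num
        _ ≤ 60 ^ 2 * (L / |x|) := by gcongr; norm_num
    calc N ≤ √(60 ^ 2 * (L / |x|)) := Real.le_sqrt_of_sq_le b4
      _ = 60 * √(L / |x|) := by
        rw [Real.sqrt_mul (by norm_num), Real.sqrt_sq (by norm_num)]
  · have hL0 : 0 < L := by linarith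
    have hlam : 0 < |x| / (32 * L) := by positivity
    refine (norm_integral_exp_le_of_le_deriv2 hab hlam h1 h2 hc fun ξ hξ => ?_).trans ?_
    · refine le_trans ?_ (hd2 ξ hξ)
      rw [div_le_iff₀ (by positivity)]
      nlinarith
    · rw [div_le_iff₀ (Real.sqrt_pos.2 hlam), mul_assoc, ← Real.sqrt_mul (by positivity)]
      have : (L / |x|) * (|x| / (32 * L)) = 1 / 32 := by field_simp
      rw [this]
      have : (1 / 6 : ℝ) ≤ √(1 / 32) := Real.le_sqrt_of_sq_le (by norm_num)
      linarith

/-- Integration against an amplitude costs its size and its total variation. -/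
lemma norm_integral_mul_amplitude_le {f α : ℝ → ℂ} {a b B A₀ A₁ : ℝ} (hab : a ≤ b)
    (hf : Continuous f) (hα : ContDiff ℝ ∞ α) (hB : ∀ c ∈ Set.Icc a b, ‖∫ ξ in a..c, f ξ‖ ≤ B)
    (h0 : ‖α b‖ ≤ A₀) (h1 : ∀ ξ, ‖deriv α ξ‖ ≤ A₁) :
    ‖∫ ξ in a..b, f ξ * α ξ‖ ≤ B * (A₀ + A₁ * (b - a)) := by
  have hB0 : 0 ≤ B := (norm_nonneg _).trans (hB a ⟨le_rfl, hab⟩)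
  have hdα : Continuous (deriv α) := hα.continuous_deriv (by norm_cast)
  have hp := intervalIntegral.integral_mul_deriv_eq_deriv_mul (a := a) (b := b) (u := α)
    (u' := deriv α) (v := fun c => ∫ ξ in a..c, f ξ) (v' := f)
    (fun x _ => (hα.differentiable (by norm_cast) x).hasDerivAt)
    (fun x _ => hf.integral_hasStrictDerivAt a x |>.hasDerivAt)
    (hdα.intervalIntegrable _ _) (hf.intervalIntegrable _ _)
  rw [intervalIntegral.integral_same, mul_zero, sub_zero] at hp
  have : (fun ξ => f ξ * α ξ) = fun ξ => α ξ * f ξ := by ext; ring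
  rw [this, hp]
  have e1 : ‖α b * ∫ ξ in a..b, f ξ‖ ≤ A₀ * B := by
    rw [norm_mul]
    exact mul_le_mul h0 (hB b ⟨hab, le_rfl⟩) (norm_nonneg _) ((norm_nonneg _).trans h0)
  have e2 : ‖∫ c in a..b, deriv α c * ∫ ξ in a..c, f ξ‖ ≤ A₁ * B * |b - a| := by
    refine intervalIntegral.norm_integral_le_of_norm_le_const fun c hc => ?_
    rw [Set.uIoc_of_le hab] at hc
    rw [norm_mul]
    exact mul_le_mul (h1 c) (hB c ⟨hc.1.le, hc.2⟩) (norm_nonneg _) ((norm_nonneg _).trans (h1 c))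
  rw [abs_of_nonneg (by linarith)] at e2
  refine (norm_sub_le _ _).trans ?_
  nlinarith

/-! ### The kernel estimate -/

section Kernel

variable {α : ℕ → ℝ → ℂ}

lemma IsDyadicFamily.exists_bound (hα : IsDyadicFamily α) : ∃ C : ℝ, 0 ≤ C ∧
    (∀ n ξ, ‖α n ξ‖ ≤ C) ∧ ∀ n ξ, ‖deriv (α n) ξ‖ ≤ C / 2 ^ n := by
  obtain ⟨C₀, h₀⟩ := hα.deriv_bound 0
  obtain ⟨C₁, h₁⟩ := hα.deriv_bound 1
  refine ⟨max |C₀| |C₁|, (abs_nonneg _).trans (le_max_left _ _), fun n ξ => ?_, fun n ξ => ?_⟩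
  · have := h₀ n ξ
    rw [iteratedDeriv_zero, mul_zero, pow_zero, div_one] at this
    exact this.trans ((le_abs_self _).trans (le_max_left _ _))
  · have := h₁ n ξ
    rw [iteratedDeriv_one, mul_one] at this
    refine this.trans ?_
    gcongr
    exact (le_abs_self _).trans (le_max_right _ _)

lemma IsDyadicFamily.eq_zero (hα : IsDyadicFamily α) (n : ℕ) {ξ : ℝ}
    (h : (2 : ℝ) ^ (n + 1) < |ξ|) : α n ξ = 0 := by
  by_contra h0
  have hm := subset_tsupport _ (Function.mem_support.2 h0)
  cases n with
  | zero => have := hα.supp_zero hm; norm_num at h this; linarith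
  | succ n => exact absurd (hα.supp_succ n hm).2 (not_le.2 h)

lemma IsDyadicFamily.eq_zero_of_lt (hα : IsDyadicFamily α) (n : ℕ) {ξ : ℝ}
    (h : |ξ| < (2 : ℝ) ^ n) : α (n + 1) ξ = 0 := by
  by_contra h0
  have hm := subset_tsupport _ (Function.mem_support.2 h0)
  exact absurd (hα.supp_succ n hm).1 (not_le.2 h)

lemma IsDyadicFamily.hasCompactSupport (hα : IsDyadicFamily α) (n : ℕ) :
    HasCompactSupport (α n) := by
  refine HasCompactSupport.of_support_subset_isCompact
    (isCompact_closedBall (0 : ℝ) (2 ^ (n + 1))) fun ξ hξ => ?_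
  rw [mem_closedBall_zero_iff, Real.norm_eq_abs]
  by_contra h
  exact hξ (IsDyadicFamily.eq_zero hα n (not_le.1 h))

lemma norm_integral_exp_dysthePhase_mul_le (hα : IsDyadicFamily α) {C : ℝ}
    (h0 : ∀ n ξ, ‖α n ξ‖ ≤ C) (h1 : ∀ n ξ, ‖deriv (α n) ξ‖ ≤ C / 2 ^ n) {n : ℕ} (hn : 6 ≤ n)
    {μ : ℝ} (hμ : |μ| ≤ 2 ^ n / 8) (t x : ℝ) (hx : x ≠ 0) :
    ‖∫ ξ, Complex.exp (Complex.I * ((ξ * x + t * dysthePhase ξ μ : ℝ) : ℂ)) * α (n + 1) ξ‖ ≤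
      300 * C * √(2 ^ n / |x|) := by
  set L : ℝ := 2 ^ n with hLd
  have hL : 64 ≤ L := by
    calc (64 : ℝ) = 2 ^ 6 := by norm_num
      _ ≤ 2 ^ n := pow_le_pow_right₀ (by norm_num) hn
  have hL2 : (2 : ℝ) ^ (n + 1 + 1) = 4 * L := by rw [hLd]; ring
  set f : ℝ → ℂ := fun ξ => Complex.exp (Complex.I * ((ξ * x + t * dysthePhase ξ μ : ℝ) : ℂ))
    with hf
  have hfc : Continuous f := by unfold f dysthePhase; fun_prop
  have hαc : Continuous (α (n + 1)) := (hα.smooth _).continuous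
  have hgi : ∀ a b, IntervalIntegrable (fun ξ => f ξ * α (n + 1) ξ) volume a b := fun a b =>
    (hfc.mul hαc).intervalIntegrable a b
  have hpiece : ∀ a b : ℝ, a ≤ b → b - a = 3 * L →
      ((L ≤ a ∧ b ≤ 4 * L) ∨ (-(4 * L) ≤ a ∧ b ≤ -L)) →
      ‖∫ ξ in a..b, f ξ * α (n + 1) ξ‖ ≤ 150 * C * √(L / |x|) := by
    intro a b hab hlen hI
    refine (norm_integral_mul_amplitude_le (A₀ := C) (A₁ := C / 2 ^ (n + 1)) hab hfc (hα.smooth _)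
      (fun c hc => norm_integral_exp_dysthePhase_le t x hL hμ hc.1 ?_ hx) (h0 _ _)
      (h1 _)).trans ?_
    · rcases hI with h | h
      · exact Or.inl ⟨h.1, hc.2.trans h.2⟩
      · exact Or.inr ⟨h.1, hc.2.trans h.2⟩
    · rw [hlen]
      have : C / 2 ^ (n + 1) * (3 * L) = 3 / 2 * C := by
        rw [pow_succ, ← hLd]; field_simp
      rw [this]
      apply le_of_eq
      ring
  have hsplit : (∫ ξ, f ξ * α (n + 1) ξ) =
      (∫ ξ in (-(4 * L))..(-L), f ξ * α (n + 1) ξ) + ∫ ξ in L..(4 * L), f ξ * α (n + 1) ξ := by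
    have hz : (∫ ξ in (-L)..L, f ξ * α (n + 1) ξ) = 0 := by
      rw [intervalIntegral.integral_of_le (by linarith), integral_Ioc_eq_integral_Ioo]
      refine setIntegral_eq_zero_of_forall_eq_zero fun ξ hξ => ?_
      rw [IsDyadicFamily.eq_zero_of_lt hα n (abs_lt.2 hξ), mul_zero]
    have ht : (∫ ξ in (-(4 * L))..(4 * L), f ξ * α (n + 1) ξ) = ∫ ξ, f ξ * α (n + 1) ξ := by
      rw [intervalIntegral.integral_of_le (by linarith), ← integral_Icc_eq_integral_Ioc]
      refine setIntegral_eq_integral_of_forall_compl_eq_zero fun ξ hξ => ?_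
      rw [IsDyadicFamily.eq_zero hα (n + 1), mul_zero]
      rw [hL2]
      by_contra h
      exact hξ (abs_le.1 (not_lt.1 h))
    rw [← ht, ← intervalIntegral.integral_add_adjacent_intervals (hgi (-(4 * L)) (-L)) (hgi _ _),
      ← intervalIntegral.integral_add_adjacent_intervals (hgi (-L) L) (hgi _ _), hz, zero_add]
  rw [hsplit]
  refine (norm_add_le _ _).trans ((add_le_add
    (hpiece (-(4 * L)) (-L) (by linarith) (by ring) (Or.inr ⟨le_rfl, le_rfl⟩))
    (hpiece L (4 * L) (by linarith) (by ring) (Or.inl ⟨le_rfl, le_rfl⟩))).trans (le_of_eq ?_))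
  ring

/-- The kernel estimate: oscillation is used only in `ξ`, the `μ` integral is estimated by the
length of its domain. -/
theorem exists_norm_dyadicKernel_le (hα : IsDyadicFamily α) :
    ∃ C : ℝ, ∀ k j : ℕ, 7 ≤ k → j + 4 < k → ∀ t x y : ℝ, x ≠ 0 →
      ‖dyadicKernel α k j t x y‖ ≤
        C * |x| ^ (-(1 / 2 : ℝ)) * (2 : ℝ) ^ ((j : ℝ) + (k : ℝ) / 2) := by
  obtain ⟨C, hC, h0, h1⟩ := IsDyadicFamily.exists_bound hα
  refine ⟨1200 * C ^ 2, fun k j hk hjk t x y hx => ?_⟩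
  obtain ⟨n, rfl⟩ : ∃ n, k = n + 1 := ⟨k - 1, by omega⟩
  have hcα : ∀ n, Continuous (α n) := fun n => (hα.smooth n).continuous
  have hint : Integrable (fun p : ℝ × ℝ =>
      Complex.exp (Complex.I * ((p.1 * x + p.2 * y + t * dysthePhase p.1 p.2 : ℝ) : ℂ)) *
        α (n + 1) p.1 * α j p.2) (volume.prod volume) := by
    have hc : Continuous (fun p : ℝ × ℝ =>
      Complex.exp (Complex.I * ((p.1 * x + p.2 * y + t * dysthePhase p.1 p.2 : ℝ) : ℂ)) *
        α (n + 1) p.1 * α j p.2) := by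
      have := hcα (n + 1)
      have := hcα j
      unfold dysthePhase
      fun_prop
    refine hc.integrable_of_hasCompactSupport (HasCompactSupport.of_support_subset_isCompact
      ((IsDyadicFamily.hasCompactSupport hα (n + 1)).isCompact.prod
        (IsDyadicFamily.hasCompactSupport hα j).isCompact) fun p hp => ?_)
    have hp' := Function.mem_support.1 hp
    exact ⟨subset_tsupport _ (right_ne_zero_of_mul (left_ne_zero_of_mul hp')),
      subset_tsupport _ (right_ne_zero_of_mul hp')⟩
  unfold dyadicKernel
  rw [Measure.volume_eq_prod, integral_prod_symm _ hint]
  have hin : ∀ μ : ℝ, (∫ ξ, Complex.exp (Complex.I *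
      ((ξ * x + μ * y + t * dysthePhase ξ μ : ℝ) : ℂ)) * α (n + 1) ξ * α j μ) =
      (Complex.exp (Complex.I * ((μ * y : ℝ) : ℂ)) * α j μ) * ∫ ξ, Complex.exp (Complex.I *
        ((ξ * x + t * dysthePhase ξ μ : ℝ) : ℂ)) * α (n + 1) ξ := by
    intro μ
    rw [← integral_const_mul]
    congr 1
    ext ξ
    rw [show ((ξ * x + μ * y + t * dysthePhase ξ μ : ℝ) : ℂ) = ((μ * y : ℝ) : ℂ) +
      ((ξ * x + t * dysthePhase ξ μ : ℝ) : ℂ) by push_cast; ring, mul_add, Complex.exp_add]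
    ring
  simp only [hin]
  set R : ℝ := 2 ^ (j + 1) with hR
  have hR0 : 0 < R := by positivity
  rw [← setIntegral_eq_integral_of_forall_compl_eq_zero (s := Set.Icc (-R) R) (fun μ hμ => by
    rw [IsDyadicFamily.eq_zero hα j, mul_zero, zero_mul]
    by_contra h
    exact hμ (abs_le.1 (not_lt.1 h)))]
  have hbound : ∀ μ ∈ Set.Icc (-R) R, ‖(Complex.exp (Complex.I * ((μ * y : ℝ) : ℂ)) * α j μ) *
      ∫ ξ, Complex.exp (Complex.I * ((ξ * x + t * dysthePhase ξ μ : ℝ) : ℂ)) * α (n + 1) ξ‖ ≤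
      C * (300 * C * √(2 ^ n / |x|)) := by
    intro μ hμ
    have hμ' : |μ| ≤ 2 ^ n / 8 := by
      refine (abs_le.2 hμ).trans ?_
      rw [le_div_iff₀ (by norm_num), hR, show (8 : ℝ) = 2 ^ 3 by norm_num, ← pow_add]
      exact pow_le_pow_right₀ (by norm_num) (by omega)
    rw [norm_mul, norm_mul, norm_exp_I_mul_ofReal, one_mul]
    exact mul_le_mul (h0 _ _)
      (norm_integral_exp_dysthePhase_mul_le hα h0 h1 (by omega) hμ' t x hx) (norm_nonneg _) hC
  refine (norm_setIntegral_le_of_norm_le_const (by simp) hbound).trans ?_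
  have hvol : volume.real (Set.Icc (-R) R) = 4 * 2 ^ j := by
    rw [Real.volume_real_Icc_of_le (by linarith), hR]; ring
  rw [hvol, Real.sqrt_div (by positivity), Real.rpow_add (by norm_num), Real.rpow_natCast,
    Real.rpow_neg (abs_nonneg x), ← Real.sqrt_eq_rpow]
  have hs : √((2 : ℝ) ^ n) ≤ 2 ^ (((n + 1 : ℕ) : ℝ) / 2) := by
    rw [Real.sqrt_eq_rpow, ← Real.rpow_natCast, ← Real.rpow_mul (by norm_num)]
    refine Real.rpow_le_rpow_of_exponent_le (by norm_num) ?_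
    push_cast
    linarith
  calc C * (300 * C * (√(2 ^ n) / √|x|)) * (4 * 2 ^ j)
      = 1200 * C ^ 2 * (√|x|)⁻¹ * (2 ^ j * √(2 ^ n)) := by ring
    _ ≤ _ := by gcongr

end Kernel

/-! ### A fractional integration inequality -/

lemma lintegral_even {f : ℝ → ℝ≥0∞} (hf : ∀ z, f (-z) = f z) :
    ∫⁻ z, f z = 2 * ∫⁻ z in Set.Ioi 0, f z := by
  have h1 : ∫⁻ z in Set.Iio 0, f z = ∫⁻ z in Set.Ioi 0, f z := by
    have := (Measure.measurePreserving_neg (volume : Measure ℝ)).setLIntegral_comp_preimage_emb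
      (MeasurableEquiv.neg ℝ).measurableEmbedding f (Set.Ioi 0)
    rw [← this]
    simp [hf]
  rw [← lintegral_add_compl f (measurableSet_Ioi (a := (0 : ℝ))), Set.compl_Ioi,
    setLIntegral_congr (Iio_ae_eq_Iic (a := (0 : ℝ))).symm, h1, two_mul]

lemma enorm_rpow_of_pos {z : ℝ} (hz : 0 < z) (s : ℝ) : ‖z‖ₑ ^ s = ENNReal.ofReal (z ^ s) := by
  rw [Real.enorm_of_nonneg hz.le, ENNReal.ofReal_rpow_of_pos hz]

lemma lintegral_enorm_rpow_near {δ : ℝ} (hδ : 0 < δ) :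
    ∫⁻ z in {z : ℝ | |z| < δ}, ‖z‖ₑ ^ (-(1 / 2) : ℝ) ≤ ENNReal.ofReal (4 * √δ) := by
  have hm : MeasurableSet {z : ℝ | |z| < δ} := measurableSet_lt (by fun_prop) (by fun_prop)
  rw [← lintegral_indicator hm, lintegral_even (fun z => by simp [Set.indicator])]
  have h1 : ∫⁻ z in Set.Ioi (0 : ℝ), {z : ℝ | |z| < δ}.indicator
      (fun z => ‖z‖ₑ ^ (-(1 / 2) : ℝ)) z =
        ∫⁻ z in Set.Ioc 0 δ, ENNReal.ofReal (z ^ (-(1 / 2) : ℝ)) := by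
    rw [setLIntegral_indicator hm, ← setLIntegral_congr Ioo_ae_eq_Ioc]
    have : {z : ℝ | |z| < δ} ∩ Set.Ioi 0 = Set.Ioo 0 δ := by
      ext z
      simp only [Set.mem_inter_iff, Set.mem_ofPred_eq, Set.mem_Ioi, Set.mem_Ioo]
      constructor
      · rintro ⟨h, h0⟩; exact ⟨h0, (le_abs_self z).trans_lt h⟩
      · rintro ⟨h0, h⟩; exact ⟨by rwa [abs_of_pos h0], h0⟩
    rw [this]
    exact setLIntegral_congr_fun measurableSet_Ioo fun z hz => enorm_rpow_of_pos hz.1 _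
  have hint : IntervalIntegrable (fun z : ℝ => z ^ (-(1 / 2) : ℝ)) volume 0 δ :=
    intervalIntegral.intervalIntegrable_rpow' (by norm_num)
  rw [h1, ← ofReal_integral_eq_lintegral_ofReal
    ((intervalIntegrable_iff_integrableOn_Ioc_of_le hδ.le).1 hint)
    ((ae_restrict_iff' measurableSet_Ioc).2 (Filter.Eventually.of_forall fun z hz =>
      Real.rpow_nonneg hz.1.le _)),
    ← intervalIntegral.integral_of_le hδ.le, integral_rpow (Or.inl (by norm_num)),
    ← ENNReal.ofReal_ofNat, ← ENNReal.ofReal_mul (by norm_num)]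
  refine ENNReal.ofReal_le_ofReal (le_of_eq ?_)
  rw [Real.sqrt_eq_rpow]
  norm_num
  ring

lemma lintegral_enorm_rpow_far {δ : ℝ} (hδ : 0 < δ) :
    ∫⁻ z in {z : ℝ | δ ≤ |z|}, ‖z‖ₑ ^ (-2 : ℝ) ≤ ENNReal.ofReal (2 / δ) := by
  have hm : MeasurableSet {z : ℝ | δ ≤ |z|} := measurableSet_le (by fun_prop) (by fun_prop)
  rw [← lintegral_indicator hm, lintegral_even (fun z => by simp [Set.indicator])]
  have h1 : ∫⁻ z in Set.Ioi (0 : ℝ), {z : ℝ | δ ≤ |z|}.indicator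
      (fun z => ‖z‖ₑ ^ (-2 : ℝ)) z = ∫⁻ z in Set.Ioi δ, ENNReal.ofReal (z ^ (-2 : ℝ)) := by
    rw [setLIntegral_indicator hm, setLIntegral_congr Ioi_ae_eq_Ici]
    have : {z : ℝ | δ ≤ |z|} ∩ Set.Ioi 0 = Set.Ici δ := by
      ext z
      simp only [Set.mem_inter_iff, Set.mem_ofPred_eq, Set.mem_Ioi, Set.mem_Ici]
      constructor
      · rintro ⟨h, h0⟩; rwa [abs_of_pos h0] at h
      · intro h; exact ⟨h.trans (le_abs_self z), hδ.trans_le h⟩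
    rw [this]
    exact setLIntegral_congr_fun measurableSet_Ici fun z hz =>
      enorm_rpow_of_pos (hδ.trans_le hz) _
  rw [h1, ← ofReal_integral_eq_lintegral_ofReal
    (integrableOn_Ioi_rpow_of_lt (by norm_num) hδ)
    ((ae_restrict_iff' measurableSet_Ioi).2 (Filter.Eventually.of_forall fun z hz =>
      Real.rpow_nonneg (hδ.trans hz).le _)),
    integral_Ioi_rpow_of_lt (by norm_num) hδ,
    ← ENNReal.ofReal_ofNat, ← ENNReal.ofReal_mul (by norm_num)]
  refine ENNReal.ofReal_le_ofReal (le_of_eq ?_)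
  norm_num
  rw [Real.rpow_neg_one]
  ring

/-- The truncated potential of `w ^ 3`. The cut at distance `δ = (r / s) ^ 4` balances the
truncation level `s ^ 3` inside against Hölder's inequality outside. -/
lemma lintegral_min_mul_enorm_rpow_le {ν : Measure ℝ} (hν : ν ≤ volume) {w : ℝ → ℝ≥0∞}
    (hw : Measurable w) {r : ℝ≥0} (hr : 0 < r) (hN : ∫⁻ x, w x ^ 4 ∂ν ≤ (r : ℝ≥0∞) ^ 4)
    (s : ℝ≥0) (x : ℝ) :
    ∫⁻ x', min (w x' ^ 3) ((s : ℝ≥0∞) ^ 3) * ‖x - x'‖ₑ ^ (-(1 / 2) : ℝ) ∂ν ≤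
      6 * (s : ℝ≥0∞) * (r : ℝ≥0∞) ^ 2 := by
  rcases eq_zero_or_pos s with rfl | hs
  · simp
  set δ : ℝ := ((r : ℝ) / s) ^ 4 with hδd
  have hs' : (0 : ℝ) < s := by exact_mod_cast hs
  have hr' : (0 : ℝ) < r := by exact_mod_cast hr
  have hδ : 0 < δ := by positivity
  set S : Set ℝ := {x' | |x - x'| < δ} with hS
  have hSm : MeasurableSet S := measurableSet_lt (by fun_prop) (by fun_prop)
  have hShift : ∀ (T : Set ℝ) (_ : MeasurableSet T) (f : ℝ → ℝ≥0∞),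
      ∫⁻ x' in {x' | x - x' ∈ T}, f (x - x') = ∫⁻ z in T, f z := by
    intro T hT f
    have hT' : MeasurableSet {x' | x - x' ∈ T} := (measurable_id.const_sub x) hT
    rw [← lintegral_indicator hT', ← lintegral_indicator hT,
      ← lintegral_sub_left_eq_self (T.indicator f) x]
    rfl
  rw [← lintegral_add_compl _ hSm]
  have hnear : ∫⁻ x' in S, min (w x' ^ 3) ((s : ℝ≥0∞) ^ 3) * ‖x - x'‖ₑ ^ (-(1 / 2) : ℝ) ∂ν ≤
      4 * (s : ℝ≥0∞) * (r : ℝ≥0∞) ^ 2 := by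
    calc _ ≤ ∫⁻ x' in S, (s : ℝ≥0∞) ^ 3 * ‖x - x'‖ₑ ^ (-(1 / 2) : ℝ) :=
          (lintegral_mono fun x' => mul_le_mul_left (min_le_right _ _) _).trans
            (lintegral_mono' (Measure.restrict_mono le_rfl hν) le_rfl)
      _ = (s : ℝ≥0∞) ^ 3 * ∫⁻ x' in S, ‖x - x'‖ₑ ^ (-(1 / 2) : ℝ) := by
          rw [lintegral_const_mul' _ _ (by simp)]
      _ ≤ (s : ℝ≥0∞) ^ 3 * ENNReal.ofReal (4 * √δ) := by
          gcongr
          refine (hShift {z | |z| < δ} (measurableSet_lt (by fun_prop) (by fun_prop))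
            fun z => ‖z‖ₑ ^ (-(1 / 2) : ℝ)).trans_le (lintegral_enorm_rpow_near hδ)
      _ = 4 * (s : ℝ≥0∞) * (r : ℝ≥0∞) ^ 2 := by
          have : √δ = ((r : ℝ) / s) ^ 2 := by
            rw [hδd, show ((r : ℝ) / s) ^ 4 = (((r : ℝ) / s) ^ 2) ^ 2 by ring,
              Real.sqrt_sq (by positivity)]
          rw [this, show 4 * ((r : ℝ) / s) ^ 2 = ((4 * (r / s) ^ 2 : ℝ≥0) : ℝ) by push_cast; rfl,
            ENNReal.ofReal_coe_nnreal]
          norm_cast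
          field_simp
  have hfar : ∫⁻ x' in Sᶜ, min (w x' ^ 3) ((s : ℝ≥0∞) ^ 3) * ‖x - x'‖ₑ ^ (-(1 / 2) : ℝ) ∂ν ≤
      2 * (s : ℝ≥0∞) * (r : ℝ≥0∞) ^ 2 := by
    have hk : Measurable fun x' => ‖x - x'‖ₑ ^ (-(1 / 2) : ℝ) := by fun_prop
    have hpq : (4 / 3 : ℝ).HolderConjugate 4 := by
      rw [Real.holderConjugate_iff]; norm_num
    calc _ ≤ ∫⁻ x' in Sᶜ, (fun x' => w x' ^ 3) x' * (fun x' => ‖x - x'‖ₑ ^ (-(1 / 2) : ℝ)) x' ∂ν :=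
          lintegral_mono fun x' => mul_le_mul_left (min_le_left _ _) _
      _ ≤ (∫⁻ x' in Sᶜ, (w x' ^ 3) ^ (4 / 3 : ℝ) ∂ν) ^ (1 / (4 / 3) : ℝ) *
          (∫⁻ x' in Sᶜ, (‖x - x'‖ₑ ^ (-(1 / 2) : ℝ)) ^ (4 : ℝ) ∂ν) ^ (1 / 4 : ℝ) :=
          ENNReal.lintegral_mul_le_Lp_mul_Lq _ hpq (hw.pow_const 3).aemeasurable hk.aemeasurable
      _ ≤ ((r : ℝ≥0∞) ^ 4) ^ (1 / (4 / 3) : ℝ) * (ENNReal.ofReal (2 / δ)) ^ (1 / 4 : ℝ) := by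
          gcongr
          · have : ∀ x', (w x' ^ 3) ^ (4 / 3 : ℝ) = w x' ^ 4 := fun x' => by
              rw [← ENNReal.rpow_natCast, ← ENNReal.rpow_natCast, ← ENNReal.rpow_mul]
              norm_num
            simp only [this]
            exact (setLIntegral_le_lintegral _ _).trans hN
          · have : ∀ x', (‖x - x'‖ₑ ^ (-(1 / 2) : ℝ)) ^ (4 : ℝ) = ‖x - x'‖ₑ ^ (-2 : ℝ) :=
              fun x' => by rw [← ENNReal.rpow_mul]; norm_num
            simp only [this]
            refine (lintegral_mono' (Measure.restrict_mono le_rfl hν) le_rfl).trans ?_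
            have hc : Sᶜ = {x' | x - x' ∈ {z : ℝ | δ ≤ |z|}} := by
              ext x'; simp [hS]
            rw [hc]
            exact (hShift {z | δ ≤ |z|} (measurableSet_le (by fun_prop) (by fun_prop))
              fun z => ‖z‖ₑ ^ (-2 : ℝ)).trans_le (lintegral_enorm_rpow_far hδ)
      _ ≤ (r : ℝ≥0∞) ^ 3 * (2 * ((s / r : ℝ≥0) : ℝ≥0∞)) := by
          gcongr
          · rw [← ENNReal.rpow_natCast, ← ENNReal.rpow_natCast, ← ENNReal.rpow_mul]
            norm_num
          · have h2 : ENNReal.ofReal (2 / δ) ≤ (2 * ((s / r : ℝ≥0) : ℝ≥0∞)) ^ (4 : ℝ) := by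
              have : (2 / δ : ℝ) = ((2 * (s / r) ^ 4 : ℝ≥0) : ℝ) := by
                rw [hδd]; push_cast; field_simp
              rw [this, ENNReal.ofReal_coe_nnreal, show (4 : ℝ) = ((4 : ℕ) : ℝ) by norm_num,
                ENNReal.rpow_natCast]
              norm_cast
              rw [mul_pow]
              gcongr
              norm_num
            refine (ENNReal.rpow_le_rpow h2 (by norm_num)).trans ?_
            rw [← ENNReal.rpow_mul]
            norm_num
      _ = 2 * (s : ℝ≥0∞) * (r : ℝ≥0∞) ^ 2 := by
          norm_cast
          field_simp
  calc _ ≤ 4 * (s : ℝ≥0∞) * (r : ℝ≥0∞) ^ 2 + 2 * (s : ℝ≥0∞) * (r : ℝ≥0∞) ^ 2 :=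
        add_le_add hnear hfar
    _ = 6 * (s : ℝ≥0∞) * (r : ℝ≥0∞) ^ 2 := by ring

/-- The Hardy–Littlewood–Sobolev inequality `L^{4/3} → L^4` for the kernel `|x|^{-1/2}`, in
quadratic form and for functions written as `w ^ 3`. Splitting according to which of the two
values is larger reduces it to the potential of a truncated function. -/
lemma lintegral_lintegral_mul_enorm_rpow_le {ν : Measure ℝ} [SFinite ν] (hν : ν ≤ volume)
    {w : ℝ → ℝ≥0} (hw : Measurable w) {r : ℝ≥0} (hr : 0 < r)
    (hN : ∫⁻ x, (w x : ℝ≥0∞) ^ 4 ∂ν ≤ (r : ℝ≥0∞) ^ 4) :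
    ∫⁻ x, ∫⁻ x', (w x : ℝ≥0∞) ^ 3 * (w x' : ℝ≥0∞) ^ 3 * ‖x - x'‖ₑ ^ (-(1 / 2) : ℝ) ∂ν ∂ν ≤
      12 * (r : ℝ≥0∞) ^ 6 := by
  set G : ℝ → ℝ → ℝ≥0∞ := fun x x' => (w x : ℝ≥0∞) ^ 3 *
    (min ((w x' : ℝ≥0∞) ^ 3) ((w x : ℝ≥0∞) ^ 3) * ‖x - x'‖ₑ ^ (-(1 / 2) : ℝ)) with hG
  have hGm : Measurable (Function.uncurry G) := by
    simp only [hG, Function.uncurry_def]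
    fun_prop
  have hG1 : ∫⁻ x, ∫⁻ x', G x x' ∂ν ∂ν ≤ 6 * (r : ℝ≥0∞) ^ 6 := by
    calc _ ≤ ∫⁻ x, 6 * (r : ℝ≥0∞) ^ 2 * (w x : ℝ≥0∞) ^ 4 ∂ν := by
          refine lintegral_mono fun x => ?_
          simp only [hG]
          rw [lintegral_const_mul' _ _ (by simp)]
          refine (mul_le_mul_right (lintegral_min_mul_enorm_rpow_le hν hw.coe_nnreal_ennreal hr hN
            (w x) x) _).trans (le_of_eq ?_)
          ring
      _ = 6 * (r : ℝ≥0∞) ^ 2 * ∫⁻ x, (w x : ℝ≥0∞) ^ 4 ∂ν := by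
          rw [lintegral_const_mul' _ _ (by finiteness)]
      _ ≤ 6 * (r : ℝ≥0∞) ^ 2 * (r : ℝ≥0∞) ^ 4 := by gcongr
      _ = 6 * (r : ℝ≥0∞) ^ 6 := by ring
  calc _ ≤ ∫⁻ x, ∫⁻ x', (G x x' + G x' x) ∂ν ∂ν := by
        refine lintegral_mono fun x => lintegral_mono fun x' => ?_
        simp only [hG]
        rw [show ‖x' - x‖ₑ = ‖x - x'‖ₑ by rw [← enorm_neg, neg_sub]]
        rcases le_total ((w x' : ℝ≥0∞) ^ 3) ((w x : ℝ≥0∞) ^ 3) with h | h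
        · rw [min_eq_left h, ← mul_assoc]
          exact le_self_add
        · rw [min_eq_left h, ← mul_assoc, ← mul_assoc, mul_comm ((w x' : ℝ≥0∞) ^ 3)]
          exact le_add_self
    _ = ∫⁻ x, ∫⁻ x', G x x' ∂ν ∂ν + ∫⁻ x, ∫⁻ x', G x' x ∂ν ∂ν := by
        have hGl : Measurable fun x => ∫⁻ x', G x x' ∂ν := hGm.lintegral_prod_right'
        rw [← lintegral_add_left hGl]
        refine lintegral_congr fun x => ?_
        have hGx : Measurable fun x' => G x x' := hGm.comp measurable_prodMk_left
        rw [lintegral_add_left hGx]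
    _ = ∫⁻ x, ∫⁻ x', G x x' ∂ν ∂ν + ∫⁻ x, ∫⁻ x', G x x' ∂ν ∂ν := by
        congr 1
        exact lintegral_lintegral_swap (hGm.comp measurable_swap).aemeasurable
    _ ≤ 6 * (r : ℝ≥0∞) ^ 6 + 6 * (r : ℝ≥0∞) ^ 6 := add_le_add hG1 hG1
    _ = 12 * (r : ℝ≥0∞) ^ 6 := by ring

/-! ### Maximal estimates from kernel bounds -/

section TTstar

variable {A : Type*} [MeasurableSpace A] {κ : Measure A} [IsFiniteMeasure κ]
  {ν : Measure ℝ} [IsFiniteMeasure ν] {e : ℝ → A → ℂ} {h : ℝ → ℂ} {M : ℝ}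

lemma lintegral_enorm_pow_of_norm_le {X : Type*} [MeasurableSpace X] {m : Measure X}
    [IsFiniteMeasure m] {f : X → ℂ} (hf : AEStronglyMeasurable f m) {C : ℝ} (hC : ∀ x, ‖f x‖ ≤ C)
    (n : ℕ) : ∫⁻ x, ‖f x‖ₑ ^ n ∂m = ‖∫ x, ((‖f x‖ ^ n : ℝ) : ℂ) ∂m‖ₑ := by
  rw [integral_complex_ofReal, ← ofReal_norm, Complex.norm_real, Real.norm_of_nonneg
    (integral_nonneg fun x => by positivity), ofReal_integral_eq_lintegral_ofReal]
  · refine lintegral_congr fun x => ?_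
    rw [ENNReal.ofReal_pow (norm_nonneg _), ofReal_norm]
  · refine Integrable.of_bound (C := C ^ n) (hf.norm.pow n)
      (Filter.Eventually.of_forall fun x => ?_)
    rw [norm_pow, norm_norm]
    exact pow_le_pow_left₀ (norm_nonneg _) (hC x) n
  · exact Filter.Eventually.of_forall fun x => by positivity

lemma integral_mul_integral_mul_eq (he : Measurable (Function.uncurry e))
    (he1 : ∀ x a, ‖e x a‖ ≤ 1) (hh : Measurable h) (hM : ∀ x, ‖h x‖ ≤ M) {g : A → ℂ}
    (hg : Integrable g κ) :
    ∫ x, (∫ a, e x a * g a ∂κ) * h x ∂ν = ∫ a, g a * ∫ x, h x * e x a ∂ν ∂κ := by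
  have hhe : StronglyMeasurable (Function.uncurry fun x a => h x * e x a) :=
    (hh.stronglyMeasurable.comp_measurable measurable_fst).mul he.stronglyMeasurable
  have hint : Integrable (Function.uncurry fun x a => h x * (e x a * g a)) (ν.prod κ) := by
    have h2 : Integrable (fun p : ℝ × A => g p.2) (ν.prod κ) := hg.comp_snd ν
    refine (h2.bdd_mul (c := M) hhe.aestronglyMeasurable
      (Filter.Eventually.of_forall fun p => ?_)).congr
      (Filter.Eventually.of_forall fun p => ?_)
    · simp only [Function.uncurry, norm_mul]
      exact (mul_le_of_le_one_right (norm_nonneg _) (he1 _ _)).trans (hM _)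
    · simp only [Function.uncurry]; ring
  calc _ = ∫ x, ∫ a, h x * (e x a * g a) ∂κ ∂ν := by
        refine integral_congr_ae (Filter.Eventually.of_forall fun x => ?_)
        simp only
        rw [integral_const_mul, mul_comm]
    _ = ∫ a, ∫ x, h x * (e x a * g a) ∂ν ∂κ := integral_integral_swap hint
    _ = _ := by
        refine integral_congr_ae (Filter.Eventually.of_forall fun a => ?_)
        simp only
        rw [← integral_const_mul]
        congr 1
        ext x
        ring

/-- The `L²` norm of the adjoint operator applied to `h`, in terms of the kernel of `T T*`. -/
lemma lintegral_enorm_integral_sq_le (he : Measurable (Function.uncurry e))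
    (he1 : ∀ x a, ‖e x a‖ ≤ 1) (hh : Measurable h) (hM : ∀ x, ‖h x‖ ≤ M) :
    ∫⁻ a, ‖∫ x, h x * e x a ∂ν‖ₑ ^ 2 ∂κ ≤
      ∫⁻ p : ℝ × ℝ, ‖h p.1‖ₑ * ‖h p.2‖ₑ *
        ‖∫ a, e p.1 a * (starRingEnd ℂ) (e p.2 a) ∂κ‖ₑ ∂(ν.prod ν) := by
  have hhe : StronglyMeasurable (Function.uncurry fun x a => h x * e x a) :=
    (hh.stronglyMeasurable.comp_measurable measurable_fst).mul he.stronglyMeasurable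
  have hhe1 : ∀ x a, ‖h x * e x a‖ ≤ M := fun x a => by
    rw [norm_mul]
    exact (mul_le_of_le_one_right (norm_nonneg _) (he1 _ _)).trans (hM _)
  have hHm : StronglyMeasurable fun a => ∫ x, h x * e x a ∂ν := hhe.integral_prod_left
  have hHb : ∀ a, ‖∫ x, h x * e x a ∂ν‖ ≤ M * ν.real Set.univ := fun a =>
    norm_integral_le_of_norm_le_const (Filter.Eventually.of_forall fun x => hhe1 x a)
  have hint : Integrable (Function.uncurry fun (a : A) (p : ℝ × ℝ) =>
      (h p.1 * e p.1 a) * (starRingEnd ℂ) (h p.2 * e p.2 a)) (κ.prod (ν.prod ν)) := by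
    refine Integrable.of_bound (C := M * M) ?_ (Filter.Eventually.of_forall fun q => ?_)
    · have m1 : Measurable fun q : A × ℝ × ℝ => h q.2.1 * e q.2.1 q.1 :=
        hhe.measurable.comp ((measurable_fst.comp measurable_snd).prodMk measurable_fst)
      have m2 : Measurable fun q : A × ℝ × ℝ => h q.2.2 * e q.2.2 q.1 :=
        hhe.measurable.comp ((measurable_snd.comp measurable_snd).prodMk measurable_fst)
      exact (m1.mul (Complex.continuous_conj.measurable.comp m2)).aestronglyMeasurable
    · simp only [Function.uncurry]
      rw [norm_mul, RCLike.norm_conj]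
      exact mul_le_mul (hhe1 _ _) (hhe1 _ _) (norm_nonneg _) ((norm_nonneg _).trans (hM 0))
  have h2 : ∫ a, ((‖∫ x, h x * e x a ∂ν‖ ^ 2 : ℝ) : ℂ) ∂κ =
      ∫ p : ℝ × ℝ, (h p.1 * (starRingEnd ℂ) (h p.2)) *
        ∫ a, e p.1 a * (starRingEnd ℂ) (e p.2 a) ∂κ ∂(ν.prod ν) := by
    calc _ = ∫ a, ∫ p : ℝ × ℝ, (h p.1 * e p.1 a) * (starRingEnd ℂ) (h p.2 * e p.2 a)
          ∂(ν.prod ν) ∂κ := by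
          refine integral_congr_ae (Filter.Eventually.of_forall fun a => ?_)
          simp only
          rw [integral_prod_mul (fun x => h x * e x a) (fun x => (starRingEnd ℂ) (h x * e x a)),
            integral_conj, Complex.mul_conj, Complex.normSq_eq_norm_sq]
      _ = _ := by
          rw [integral_integral_swap hint]
          refine integral_congr_ae (Filter.Eventually.of_forall fun p => ?_)
          simp only
          rw [← integral_const_mul]
          congr 1
          ext a
          rw [map_mul]
          ring
  rw [lintegral_enorm_pow_of_norm_le hHm.aestronglyMeasurable hHb, h2]
  refine (enorm_integral_le_lintegral_enorm _).trans (lintegral_mono fun p => ?_)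
  rw [enorm_mul, enorm_mul]
  have hc : ‖(starRingEnd ℂ) (h p.2)‖ₑ = ‖h p.2‖ₑ := by
    rw [← ofReal_norm, RCLike.norm_conj, ofReal_norm]
  rw [hc]

/-- The `T T*` argument for bounded measures in `x`: a kernel bound `B |x - x'|^{-1/2}` for the
operator `g ↦ ∫ e(x, a) g(a) da` gives its boundedness from `L²` to `L⁴`. -/
lemma lintegral_enorm_integral_mul_pow_le_of_finite (hν : ν ≤ volume)
    (he : Measurable (Function.uncurry e)) (he1 : ∀ x a, ‖e x a‖ ≤ 1) {g : A → ℂ}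
    (hg : MemLp g 2 κ) {B : ℝ≥0} (hB : 0 < B)
    (hK : ∀ x x', x ≠ x' → ‖∫ a, e x a * (starRingEnd ℂ) (e x' a) ∂κ‖ₑ ≤
      B * ‖x - x'‖ₑ ^ (-(1 / 2) : ℝ)) :
    ∫⁻ x, ‖∫ a, e x a * g a ∂κ‖ₑ ^ 4 ∂ν ≤
      (12 * B) ^ 2 * (∫⁻ a, ‖g a‖ₑ ^ 2 ∂κ) ^ 2 := by
  have hgi : Integrable g κ := hg.integrable (by norm_num)
  have hgm := hg.aestronglyMeasurable
  set w : ℝ → ℂ := fun x => ∫ a, e x a * g a ∂κ with hw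
  have hwm : Measurable w := by
    have h1 : w = fun x => ∫ a, e x a * hgm.mk g a ∂κ := by
      ext x
      exact integral_congr_ae (hgm.ae_eq_mk.mono fun a ha => by simp only [ha])
    rw [h1]
    exact ((he.stronglyMeasurable.mul (hgm.stronglyMeasurable_mk.comp_measurable
      measurable_snd)).integral_prod_right (f := fun x a => e x a * hgm.mk g a)).measurable
  have hwb : ∀ x, ‖w x‖ ≤ ∫ a, ‖g a‖ ∂κ := fun x => by
    refine norm_integral_le_of_norm_le hgi.norm (Filter.Eventually.of_forall fun a => ?_)
    rw [norm_mul]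
    exact mul_le_of_le_one_left (norm_nonneg _) (he1 _ _)
  set W : ℝ := ∫ a, ‖g a‖ ∂κ with hW
  set N : ℝ≥0∞ := ∫⁻ x, ‖w x‖ₑ ^ 4 ∂ν with hNdef
  have hNfin : N ≠ ⊤ := by
    have h1 : N ≤ ∫⁻ _, ENNReal.ofReal W ^ 4 ∂ν := by
      refine lintegral_mono fun x => ?_
      rw [← ofReal_norm]
      gcongr
      exact hwb x
    refine ne_top_of_le_ne_top ?_ h1
    rw [lintegral_const]
    finiteness
  rcases eq_or_ne N 0 with hN0 | hN0
  · rw [hN0]; positivity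
  obtain ⟨r, hr⟩ : ∃ r : ℝ≥0, (r : ℝ≥0∞) ^ 4 = N := by
    refine ⟨(N ^ (1 / 4 : ℝ)).toNNReal, ?_⟩
    rw [ENNReal.coe_toNNReal (by finiteness), ← ENNReal.rpow_natCast, ← ENNReal.rpow_mul]
    norm_num
  have hr0 : 0 < r := by
    rw [pos_iff_ne_zero]
    rintro rfl
    simp at hr
    exact hN0 hr.symm
  -- the function dual to `w` in `L⁴`
  set h : ℝ → ℂ := fun x => (starRingEnd ℂ) (w x) * (‖w x‖ : ℂ) ^ 2 with hh
  have hhm : Measurable h :=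
    (Complex.continuous_conj.measurable.comp hwm).mul
      ((Complex.measurable_ofReal.comp hwm.norm).pow_const 2)
  have hhn : ∀ x, ‖h x‖ = ‖w x‖ ^ 3 := fun x => by
    rw [hh, norm_mul, RCLike.norm_conj, norm_pow, Complex.norm_real, norm_norm]; ring
  have hhe : ∀ x, ‖h x‖ₑ = (‖w x‖₊ : ℝ≥0∞) ^ 3 := fun x => by
    rw [← ofReal_norm, hhn, ENNReal.ofReal_pow (norm_nonneg _), ofReal_norm]
    rfl
  have hhb : ∀ x, ‖h x‖ ≤ W ^ 3 := fun x => by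
    rw [hhn]; exact pow_le_pow_left₀ (norm_nonneg _) (hwb x) 3
  set H : A → ℂ := fun a => ∫ x, h x * e x a ∂ν with hH
  have hHm : StronglyMeasurable H :=
    StronglyMeasurable.integral_prod_left (f := fun x a => h x * e x a)
      ((hhm.stronglyMeasurable.comp_measurable measurable_fst).mul he.stronglyMeasurable)
  have hdual : N ≤ ∫⁻ a, ‖g a‖ₑ * ‖H a‖ₑ ∂κ := by
    have h3 : N = ‖∫ x, w x * h x ∂ν‖ₑ := by
      rw [hNdef, lintegral_enorm_pow_of_norm_le hwm.aestronglyMeasurable hwb]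
      congr 2
      ext x
      simp only [hh]
      rw [← mul_assoc, Complex.mul_conj, Complex.normSq_eq_norm_sq]
      push_cast
      ring
    rw [h3, integral_mul_integral_mul_eq he he1 hhm hhb hgi]
    refine (enorm_integral_le_lintegral_enorm _).trans (le_of_eq ?_)
    simp only [enorm_mul, hH]
  have hHsq : ∫⁻ a, ‖H a‖ₑ ^ 2 ∂κ ≤ 12 * B * (r : ℝ≥0∞) ^ 6 := by
    have hKB : ∀ x x', ‖h x‖ₑ * ‖h x'‖ₑ *
        ‖∫ a, e x a * (starRingEnd ℂ) (e x' a) ∂κ‖ₑ ≤ B * ((‖w x‖₊ : ℝ≥0∞) ^ 3 *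
        (‖w x'‖₊ : ℝ≥0∞) ^ 3 * ‖x - x'‖ₑ ^ (-(1 / 2) : ℝ)) := by
      intro x x'
      rw [hhe, hhe]
      have hKt : ‖∫ a, e x a * (starRingEnd ℂ) (e x' a) ∂κ‖ₑ ≤
          B * ‖x - x'‖ₑ ^ (-(1 / 2) : ℝ) := by
        rcases eq_or_ne x x' with rfl | hne
        · -- on the diagonal the right-hand side is `∞`
          rw [sub_self, enorm_zero, ENNReal.zero_rpow_of_neg (by norm_num),
            ENNReal.mul_top (by exact_mod_cast hB.ne')]
          exact le_top
        · exact hK x x' hne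
      calc _ ≤ (‖w x‖₊ : ℝ≥0∞) ^ 3 * (‖w x'‖₊ : ℝ≥0∞) ^ 3 *
            (B * ‖x - x'‖ₑ ^ (-(1 / 2) : ℝ)) := by gcongr
        _ = _ := by ring
    refine (lintegral_enorm_integral_sq_le he he1 hhm hhb).trans ?_
    refine (lintegral_mono fun p : ℝ × ℝ => hKB p.1 p.2).trans ?_
    rw [lintegral_const_mul' _ _ (by simp), lintegral_prod _ (by fun_prop)]
    refine (mul_le_mul_right (lintegral_lintegral_mul_enorm_rpow_le hν hwm.nnnorm hr0 hr.ge)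
      _).trans (le_of_eq ?_)
    ring
  -- `r ^ 4 ≤ ‖g‖₂ (12 B r ^ 6) ^ (1 / 2)`, and a power of `r` cancels
  set E : ℝ≥0∞ := ∫⁻ a, ‖g a‖ₑ ^ 2 ∂κ with hE
  have hCS : N ^ 2 ≤ E * (12 * B * (r : ℝ≥0∞) ^ 6) := by
    have h1 := ENNReal.lintegral_mul_le_Lp_mul_Lq κ Real.HolderConjugate.two_two
      hgm.enorm hHm.aestronglyMeasurable.enorm
    have h2 := hdual.trans h1
    simp only [ENNReal.rpow_two] at h2
    calc N ^ 2 ≤ (E ^ (1 / 2 : ℝ) * (∫⁻ a, ‖H a‖ₑ ^ 2 ∂κ) ^ (1 / 2 : ℝ)) ^ 2 := by gcongr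
      _ = E * ∫⁻ a, ‖H a‖ₑ ^ 2 ∂κ := by
          rw [mul_pow, ← ENNReal.rpow_natCast, ← ENNReal.rpow_natCast, ← ENNReal.rpow_mul,
            ← ENNReal.rpow_mul]
          norm_num
      _ ≤ _ := by gcongr
  rw [← hr] at hCS ⊢
  have h6 : (r : ℝ≥0∞) ^ 6 ≠ 0 := by positivity
  have h6' : (r : ℝ≥0∞) ^ 6 ≠ ⊤ := by finiteness
  have h7 : (r : ℝ≥0∞) ^ 2 ≤ 12 * B * E := by
    rw [← ENNReal.mul_le_mul_iff_left h6 h6']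
    calc _ = ((r : ℝ≥0∞) ^ 4) ^ 2 := by ring
      _ ≤ _ := hCS
      _ = _ := by ring
  calc (r : ℝ≥0∞) ^ 4 = ((r : ℝ≥0∞) ^ 2) ^ 2 := by ring
    _ ≤ (12 * B * E) ^ 2 := by gcongr
    _ = _ := by ring

lemma lintegral_enorm_integral_mul_pow_le (he : Measurable (Function.uncurry e))
    (he1 : ∀ x a, ‖e x a‖ ≤ 1) {g : A → ℂ} (hg : MemLp g 2 κ) {B : ℝ≥0} (hB : 0 < B)
    (hK : ∀ x x', x ≠ x' → ‖∫ a, e x a * (starRingEnd ℂ) (e x' a) ∂κ‖ₑ ≤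
      B * ‖x - x'‖ₑ ^ (-(1 / 2) : ℝ)) :
    ∫⁻ x, ‖∫ a, e x a * g a ∂κ‖ₑ ^ 4 ≤ (12 * B) ^ 2 * (∫⁻ a, ‖g a‖ₑ ^ 2 ∂κ) ^ 2 := by
  have hgm := hg.aestronglyMeasurable
  have hwm : Measurable fun x => ∫ a, e x a * g a ∂κ := by
    have h1 : (fun x => ∫ a, e x a * g a ∂κ) = fun x => ∫ a, e x a * hgm.mk g a ∂κ := by
      ext x
      exact integral_congr_ae (hgm.ae_eq_mk.mono fun a ha => by simp only [ha])
    rw [h1]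
    exact ((he.stronglyMeasurable.mul (hgm.stronglyMeasurable_mk.comp_measurable
      measurable_snd)).integral_prod_right (f := fun x a => e x a * hgm.mk g a)).measurable
  have hcov : AECover (volume : Measure ℝ) Filter.atTop fun n : ℕ => Set.Icc (-(n : ℝ)) n :=
    aecover_Icc (Filter.tendsto_neg_atTop_atBot.comp tendsto_natCast_atTop_atTop)
      tendsto_natCast_atTop_atTop
  exact le_of_tendsto' (hcov.lintegral_tendsto_of_countably_generated
    (hwm.enorm.pow_const 4).aemeasurable) fun n =>
    lintegral_enorm_integral_mul_pow_le_of_finite Measure.restrict_le_self he he1 hg hB hK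

/-- Measurable selection of a maximiser among finitely many functions. -/
lemma exists_measurable_forall_le {f : ℕ → ℝ → ℝ≥0∞} (hf : ∀ n, Measurable (f n)) (N : ℕ) :
    ∃ σ : ℝ → ℕ, Measurable σ ∧ ∀ n ≤ N, ∀ x, f n x ≤ f (σ x) x := by
  induction N with
  | zero => exact ⟨fun _ => 0, measurable_const, fun n hn x => by rw [Nat.le_zero.1 hn]⟩
  | succ N ih =>
    obtain ⟨σ, hσ, hle⟩ := ih
    have hfσ : Measurable fun x => f (σ x) x :=
      (measurable_from_prod_countable_right hf : Measurable fun p : ℕ × ℝ => f p.1 p.2).comp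
        (hσ.prodMk measurable_id)
    refine ⟨fun x => if f (σ x) x ≤ f (N + 1) x then N + 1 else σ x,
      Measurable.ite (measurableSet_le hfσ (hf _)) measurable_const hσ, fun n hn x => ?_⟩
    simp only
    rcases Nat.le_succ_iff.1 hn with h | rfl
    · split_ifs with hc
      · exact (hle n h x).trans hc
      · exact hle n h x
    · split_ifs with hc
      · exact le_rfl
      · exact (not_le.1 hc).le

/-- The maximal estimate: the kernel bound is assumed for every pair of parameters `n`, `m`, so
that the `T T*` argument applies to the operator in which the parameter is a measurable function of
`x`, selected to attain the maximum over finitely many parameters. -/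
theorem lintegral_iSup_enorm_integral_mul_pow_le {e : ℕ → ℝ → A → ℂ}
    (he : ∀ n, Measurable (Function.uncurry (e n))) (he1 : ∀ n x a, ‖e n x a‖ ≤ 1) {g : A → ℂ}
    (hg : MemLp g 2 κ) {B : ℝ≥0} (hB : 0 < B)
    (hK : ∀ n m x x', x ≠ x' → ‖∫ a, e n x a * (starRingEnd ℂ) (e m x' a) ∂κ‖ₑ ≤
      B * ‖x - x'‖ₑ ^ (-(1 / 2) : ℝ)) :
    ∫⁻ x, (⨆ n, ‖∫ a, e n x a * g a ∂κ‖ₑ) ^ 4 ≤ (12 * B) ^ 2 * (∫⁻ a, ‖g a‖ₑ ^ 2 ∂κ) ^ 2 := by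
  have hgm := hg.aestronglyMeasurable
  have hfm : ∀ n, Measurable fun x => ‖∫ a, e n x a * g a ∂κ‖ₑ := by
    intro n
    have h1 : (fun x => ‖∫ a, e n x a * g a ∂κ‖ₑ) = fun x => ‖∫ a, e n x a * hgm.mk g a ∂κ‖ₑ := by
      ext x
      congr 1
      exact integral_congr_ae (hgm.ae_eq_mk.mono fun a ha => by simp only [ha])
    rw [h1]
    exact (((he n).stronglyMeasurable.mul (hgm.stronglyMeasurable_mk.comp_measurable
      measurable_snd)).integral_prod_right
      (f := fun x a => e n x a * hgm.mk g a)).measurable.enorm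
  choose σ hσ hle using exists_measurable_forall_le hfm
  have heσ : ∀ N, Measurable (Function.uncurry fun x a => e (σ N x) x a) := fun N =>
    (measurable_from_prod_countable_right he :
      Measurable fun q : ℕ × ℝ × A => Function.uncurry (e q.1) q.2).comp
      (((hσ N).comp measurable_fst).prodMk measurable_id)
  have hbound : ∀ N, ∫⁻ x, ‖∫ a, e (σ N x) x a * g a ∂κ‖ₑ ^ 4 ≤
      (12 * B) ^ 2 * (∫⁻ a, ‖g a‖ₑ ^ 2 ∂κ) ^ 2 := fun N =>
    lintegral_enorm_integral_mul_pow_le (heσ N) (fun x a => he1 _ x a) hg hB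
      fun x x' hx => hK _ _ x x' hx
  have hfσm : ∀ N, Measurable fun x => ‖∫ a, e (σ N x) x a * g a ∂κ‖ₑ ^ 4 := fun N =>
    (((measurable_from_prod_countable_right hfm :
      Measurable fun q : ℕ × ℝ => ‖∫ a, e q.1 q.2 a * g a ∂κ‖ₑ).comp
      ((hσ N).prodMk measurable_id))).pow_const 4
  calc _ ≤ ∫⁻ x, Filter.liminf (fun N => ‖∫ a, e (σ N x) x a * g a ∂κ‖ₑ ^ 4) Filter.atTop := by
        refine lintegral_mono fun x => ?_
        rw [ENNReal.iSup_pow_of_ne_zero (by norm_num)]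
        refine iSup_le fun n => Filter.le_liminf_of_le (by isBoundedDefault) ?_
        filter_upwards [Filter.eventually_ge_atTop n] with N hN
        gcongr
        exact hle N n hN x
    _ ≤ Filter.liminf (fun N => ∫⁻ x, ‖∫ a, e (σ N x) x a * g a ∂κ‖ₑ ^ 4) Filter.atTop :=
        lintegral_liminf_le hfσm
    _ ≤ _ := Filter.liminf_le_of_frequently_le' (Filter.Frequently.of_forall hbound)

end TTstar

/-- Minkowski's integral inequality in `L⁴`, with a majorant `w` of the `L⁴` norms: Hölder's
inequality for `f = (f w^{-3/4}) w^{3/4}`. -/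
lemma lintegral_lintegral_pow_four_le {T X : Type*} [MeasurableSpace T] [MeasurableSpace X]
    {ρ : Measure T} [SFinite ρ] {m : Measure X} [SFinite m]
    {f : T → X → ℝ≥0∞} (hf : Measurable (Function.uncurry f))
    {w : T → ℝ≥0} (hw : Measurable w) (h0 : ∀ t, w t = 0 → ∀ x, f t x = 0)
    (hle : ∀ t, ∫⁻ x, f t x ^ 4 ∂m ≤ (w t : ℝ≥0∞) ^ 4) :
    ∫⁻ x, (∫⁻ t, f t x ∂ρ) ^ 4 ∂m ≤ (∫⁻ t, w t ∂ρ) ^ 4 := by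
  have hpq : (4 : ℝ).HolderConjugate (4 / 3) := by
    rw [Real.holderConjugate_iff]; norm_num
  have hwe : Measurable fun t => (w t : ℝ≥0∞) := hw.coe_nnreal_ennreal
  have hftx : ∀ x, Measurable fun t => f t x := fun x => hf.comp measurable_prodMk_right
  have hpt : ∀ x, (∫⁻ t, f t x ∂ρ) ^ 4 ≤
      (∫⁻ t, f t x ^ 4 * (w t : ℝ≥0∞) ^ (-3 : ℝ) ∂ρ) * (∫⁻ t, w t ∂ρ) ^ 3 := by
    intro x
    have hsplit : ∀ t, f t x = ((fun t => f t x * (w t : ℝ≥0∞) ^ (-(3 / 4) : ℝ)) *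
        fun t => (w t : ℝ≥0∞) ^ (3 / 4 : ℝ)) t := by
      intro t
      rw [Pi.mul_apply]
      rcases eq_or_ne (w t) 0 with hz | hz
      · rw [h0 t hz x, zero_mul, zero_mul]
      · rw [mul_assoc, ← ENNReal.rpow_add _ _ (by exact_mod_cast hz) (by simp)]
        norm_num
    have hH := ENNReal.lintegral_mul_le_Lp_mul_Lq ρ hpq
      (f := fun t => f t x * (w t : ℝ≥0∞) ^ (-(3 / 4) : ℝ))
      (g := fun t => (w t : ℝ≥0∞) ^ (3 / 4 : ℝ))
      ((hftx x).mul (hwe.pow_const _)).aemeasurable (hwe.pow_const _).aemeasurable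
    rw [← lintegral_congr hsplit] at hH
    have e1 : ∀ t, (f t x * (w t : ℝ≥0∞) ^ (-(3 / 4) : ℝ)) ^ (4 : ℝ) =
        f t x ^ 4 * (w t : ℝ≥0∞) ^ (-3 : ℝ) := fun t => by
      rw [ENNReal.mul_rpow_of_nonneg _ _ (by norm_num), ← ENNReal.rpow_mul]
      norm_num
    have e2 : ∀ t, ((w t : ℝ≥0∞) ^ (3 / 4 : ℝ)) ^ (4 / 3 : ℝ) = w t := fun t => by
      rw [← ENNReal.rpow_mul]; norm_num
    simp only [e1, e2] at hH
    calc _ ≤ ((∫⁻ t, f t x ^ 4 * (w t : ℝ≥0∞) ^ (-3 : ℝ) ∂ρ) ^ (1 / 4 : ℝ) *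
          (∫⁻ t, w t ∂ρ) ^ (1 / (4 / 3) : ℝ)) ^ 4 := by gcongr
      _ = _ := by
          rw [mul_pow, ← ENNReal.rpow_natCast, ← ENNReal.rpow_natCast, ← ENNReal.rpow_natCast,
            ← ENNReal.rpow_mul, ← ENNReal.rpow_mul]
          norm_num
  have hm : Measurable fun p : X × T => f p.2 p.1 ^ 4 * (w p.2 : ℝ≥0∞) ^ (-3 : ℝ) :=
    ((hf.comp measurable_swap).pow_const 4).mul ((hwe.comp measurable_snd).pow_const _)
  calc _ ≤ ∫⁻ x, (∫⁻ t, f t x ^ 4 * (w t : ℝ≥0∞) ^ (-3 : ℝ) ∂ρ) * (∫⁻ t, w t ∂ρ) ^ 3 ∂m :=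
        lintegral_mono hpt
    _ = (∫⁻ x, ∫⁻ t, f t x ^ 4 * (w t : ℝ≥0∞) ^ (-3 : ℝ) ∂ρ ∂m) * (∫⁻ t, w t ∂ρ) ^ 3 :=
        lintegral_mul_const _ hm.lintegral_prod_right'
    _ = (∫⁻ t, ∫⁻ x, f t x ^ 4 * (w t : ℝ≥0∞) ^ (-3 : ℝ) ∂m ∂ρ) * (∫⁻ t, w t ∂ρ) ^ 3 := by
        rw [lintegral_lintegral_swap hm.aemeasurable]
    _ ≤ (∫⁻ t, w t ∂ρ) * (∫⁻ t, w t ∂ρ) ^ 3 := by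
        gcongr with t
        rcases eq_or_ne (w t) 0 with hz | hz
        · simp [h0 t hz]
        · have hz' : (w t : ℝ≥0∞) ≠ 0 := by exact_mod_cast hz
          have hft : Measurable fun x => f t x := hf.comp measurable_prodMk_left
          rw [lintegral_mul_const _ (hft.pow_const 4)]
          refine (mul_le_mul_left (hle t) _).trans (le_of_eq ?_)
          rw [← ENNReal.rpow_natCast, ← ENNReal.rpow_add _ _ hz' (by simp)]
          norm_num
    _ = _ := by ring

/-! ### Convergence in `L²` and jointly measurable representatives -/

section L2

variable {X : Type*} [MeasurableSpace X] {m : Measure X}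

lemma enorm_sq_eq_lintegral (f : Lp ℂ 2 m) : ‖f‖ₑ ^ 2 = ∫⁻ a, ‖f a‖ₑ ^ 2 ∂m := by
  rw [Lp.enorm_def, eLpNorm_eq_lintegral_rpow_enorm_toReal (by norm_num) (by norm_num),
    ← ENNReal.rpow_natCast, ← ENNReal.rpow_mul]
  simp

lemma enorm_sub_sq_eq_lintegral (f g : Lp ℂ 2 m) :
    ‖f - g‖ₑ ^ 2 = ∫⁻ a, ‖f a - g a‖ₑ ^ 2 ∂m := by
  rw [enorm_sq_eq_lintegral]
  refine lintegral_congr_ae ?_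
  filter_upwards [Lp.coeFn_sub f g] with a ha
  rw [ha, Pi.sub_apply]

/-- Dominated convergence in `L²`. -/
lemma tendsto_Lp_two_of_dominated {ι : Type*} {l : Filter ι} [l.IsCountablyGenerated]
    {F : ι → Lp ℂ 2 m} {f : Lp ℂ 2 m} {G : ι → X → ℂ} {g : X → ℂ} {h : X → ℝ≥0∞}
    (hF : ∀ i, F i =ᵐ[m] G i) (hf : f =ᵐ[m] g) (hGm : ∀ i, Measurable (G i)) (hgm : Measurable g)
    (hh : ∫⁻ a, h a ^ 2 ∂m ≠ ⊤)
    (hG : ∀ i a, ‖G i a‖ₑ ≤ h a) (hg : ∀ a, ‖g a‖ₑ ≤ h a)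
    (hlim : ∀ᵐ a ∂m, Filter.Tendsto (fun i => G i a) l (nhds (g a))) :
    Filter.Tendsto F l (nhds f) := by
  have h1 : Filter.Tendsto (fun i => ∫⁻ a, ‖G i a - g a‖ₑ ^ 2 ∂m) l (nhds 0) := by
    have := tendsto_lintegral_filter_of_dominated_convergence (μ := m) (l := l)
      (F := fun i a => ‖G i a - g a‖ₑ ^ 2) (f := fun _ => 0) (fun a => 4 * h a ^ 2)
      (Filter.Eventually.of_forall fun i => ((hGm i).sub hgm).enorm.pow_const 2)
    rw [lintegral_zero] at this
    refine this (Filter.Eventually.of_forall fun i => Filter.Eventually.of_forall fun a => ?_) ?_ ?_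
    · calc ‖G i a - g a‖ₑ ^ 2 ≤ (h a + h a) ^ 2 := by
            gcongr
            exact (enorm_sub_le).trans (add_le_add (hG i a) (hg a))
        _ = 4 * h a ^ 2 := by ring
    · rw [lintegral_const_mul' _ _ (by norm_num)]
      finiteness
    · filter_upwards [hlim] with a ha
      have h2 : Filter.Tendsto (fun i => ‖G i a - g a‖ₑ ^ 2) l (nhds (‖g a - g a‖ₑ ^ 2)) :=
        ((ENNReal.continuous_pow 2).tendsto _).comp (ha.sub_const (g a)).enorm
      simpa using h2
  have h2 : ∀ i, ‖F i - f‖ₑ ^ 2 = ∫⁻ a, ‖G i a - g a‖ₑ ^ 2 ∂m := fun i => by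
    rw [enorm_sub_sq_eq_lintegral]
    refine lintegral_congr_ae ?_
    filter_upwards [hF i, hf] with a e1 e2
    rw [e1, e2]
  rw [tendsto_iff_edist_tendsto_0]
  have h3 := ((ENNReal.continuous_rpow_const (y := (1 / 2 : ℝ))).tendsto _).comp h1
  rw [ENNReal.zero_rpow_of_pos (by norm_num)] at h3
  refine h3.congr fun i => ?_
  rw [Function.comp_apply, ← h2, edist_eq_enorm_sub, ← ENNReal.rpow_natCast, ← ENNReal.rpow_mul]
  norm_num

lemma ae_tendsto_of_enorm_sub_lt {F : ℕ → Lp ℂ 2 m} {f : Lp ℂ 2 m}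
    (h : ∀ n, ‖F n - f‖ₑ ≤ 2⁻¹ ^ n) :
    ∀ᵐ a ∂m, Filter.Tendsto (fun n => F n a) Filter.atTop (nhds (f a)) := by
  have hm : ∀ n, Measurable fun a => ‖F n a - f a‖ₑ ^ 2 := fun n =>
    ((Lp.stronglyMeasurable (F n)).sub (Lp.stronglyMeasurable f)).measurable.enorm.pow_const 2
  have h1 : ∫⁻ a, ∑' n, ‖F n a - f a‖ₑ ^ 2 ∂m ≠ ⊤ := by
    rw [lintegral_tsum fun n => (hm n).aemeasurable]
    refine ne_top_of_le_ne_top ?_ (ENNReal.tsum_le_tsum (g := fun n => 2⁻¹ ^ n) fun n => ?_)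
    · rw [ENNReal.tsum_geometric]
      norm_num
    · rw [← enorm_sub_sq_eq_lintegral]
      calc ‖F n - f‖ₑ ^ 2 ≤ (2⁻¹ ^ n) ^ 2 := by gcongr; exact h n
        _ ≤ 2⁻¹ ^ n := pow_le_of_le_one (by positivity)
          (pow_le_one₀ (by positivity) (ENNReal.inv_le_one.2 (by norm_num))) (by norm_num)
  filter_upwards [ae_lt_top (Measurable.tsum hm) h1] with a ha
  have h2 := ENNReal.tendsto_atTop_zero_of_tsum_ne_top ha.ne
  rw [tendsto_iff_edist_tendsto_0]
  have h3 := ((ENNReal.continuous_rpow_const (y := (1 / 2 : ℝ))).tendsto _).comp h2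
  rw [ENNReal.zero_rpow_of_pos (by norm_num)] at h3
  refine h3.congr fun i => ?_
  rw [Function.comp_apply, edist_eq_enorm_sub, ← ENNReal.rpow_natCast, ← ENNReal.rpow_mul]
  norm_num

end L2

/-- The plane as a product, `p ↦ (p 0, p 1)`. -/
noncomputable def planeEquiv : Plane ≃ᵐ ℝ × ℝ :=
  (MeasurableEquiv.toLp 2 (Fin 2 → ℝ)).symm.trans MeasurableEquiv.finTwoArrow

lemma planeEquiv_apply (p : Plane) : planeEquiv p = (p 0, p 1) := rfl

lemma measurePreserving_planeEquiv :
    MeasurePreserving planeEquiv (volume : Measure Plane) (volume.prod volume) :=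
  (volume_preserving_finTwoArrow ℝ).comp
    (EuclideanSpace.volume_preserving_symm_measurableEquiv_toLp (Fin 2))

/-- A strongly measurable map into `L²` is represented by a jointly measurable function: its values
are limits, at a geometric rate, of those of countably valued maps. -/
lemma exists_represents {J : Set ℝ} {U : ℝ → L2Plane}
    (hU : AEStronglyMeasurable U (volume.restrict J)) : ∃ u, Represents J U u := by
  set V := hU.mk U with hV
  have hVm : StronglyMeasurable V := hU.stronglyMeasurable_mk
  have hex : ∀ (j : ℕ) (t : ℝ), ∃ n, ‖hVm.approx n t - V t‖ₑ < 2⁻¹ ^ j := by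
    intro j t
    have h1 := (tendsto_iff_edist_tendsto_0.1 (hVm.tendsto_approx t)).eventually
      (gt_mem_nhds (ENNReal.pow_pos (show (0 : ℝ≥0∞) < 2⁻¹ by norm_num) j))
    obtain ⟨n, hn⟩ := h1.exists
    exact ⟨n, by rwa [← edist_eq_enorm_sub]⟩
  classical
  set N : ℕ → ℝ → ℕ := fun j t => Nat.find (hex j t) with hN
  have hNm : ∀ j, Measurable (N j) := fun j => by
    refine measurable_find (hex j) fun k => measurableSet_lt ?_ measurable_const
    exact ((SimpleFunc.stronglyMeasurable _).sub hVm).enorm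
  have hap : ∀ n, Measurable fun q : ℝ × Plane => hVm.approx n q.1 q.2 := fun n => by
    have h1 : ∀ f : L2Plane, Measurable fun q : ℝ × Plane => f q.2 := fun f =>
      (Lp.stronglyMeasurable f).measurable.comp measurable_snd
    exact SimpleFunc.measurable_bind ((hVm.approx n).comp Prod.fst measurable_fst)
      (fun f q => f q.2) h1
  have hvm : ∀ j, Measurable fun q : ℝ × Plane => hVm.approx (N j q.1) q.1 q.2 := fun j =>
    (measurable_from_prod_countable_right (f := fun r : ℕ × ℝ × Plane => hVm.approx r.1 r.2.1 r.2.2)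
      hap).comp (((hNm j).comp measurable_fst).prodMk measurable_id)
  refine ⟨fun t x y => Filter.limUnder Filter.atTop fun j =>
    hVm.approx (N j t) t (planeEquiv.symm (x, y)), ?_, ?_⟩
  · have hmap : Measurable fun q : ℝ × ℝ × ℝ => (q.1, planeEquiv.symm q.2) :=
      measurable_fst.prodMk (planeEquiv.symm.measurable.comp measurable_snd)
    exact (StronglyMeasurable.limUnder fun j =>
      ((hvm j).comp hmap).stronglyMeasurable).measurable
  · filter_upwards [hU.ae_eq_mk] with t ht
    rw [ht]
    have hconv := ae_tendsto_of_enorm_sub_lt (F := fun j => hVm.approx (N j t) t) (f := V t)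
      fun j => (Nat.find_spec (hex j t)).le
    filter_upwards [hconv] with p hp
    have hpp : planeEquiv.symm (p 0, p 1) = p := planeEquiv.symm_apply_apply p
    rw [hpp]
    exact hp.limUnder_eq

lemma continuous_neg_inner : Continuous fun p : Plane × Plane => (-innerₗ Plane) p.1 p.2 :=
  (continuous_inner (𝕜 := ℝ) (E := Plane)).neg

/-- On `L¹ ∩ L²` the inverse Fourier transform of `L²` is given by the integral. -/
lemma fourierInv_ae_eq_integral {G : L2Plane} (hG : Integrable G volume) :
    (𝓕⁻ G : L2Plane) =ᵐ[volume] 𝓕⁻ (G : Plane → ℂ) := by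
  have hcont : Continuous (𝓕⁻ (G : Plane → ℂ)) :=
    VectorFourier.fourierIntegral_continuous Real.continuous_fourierChar
      (L := -innerₗ Plane) continuous_neg_inner hG
  refine ae_eq_of_integral_contDiff_smul_eq
    ((Lp.memLp _).locallyIntegrable (by norm_num)) hcont.locallyIntegrable fun g hg hgc => ?_
  have hg1 : HasCompactSupport (Complex.ofRealCLM ∘ g) := hgc.comp_left rfl
  have hg2 : ContDiff ℝ ∞ (Complex.ofRealCLM ∘ g) := by fun_prop
  set φ : SchwartzMap Plane ℂ := hg1.toSchwartzMap hg2 with hφ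
  have hφ1 : ∀ x, φ x = (g x : ℂ) := fun x => rfl
  have h1 : ∫ x, g x • (𝓕⁻ G : L2Plane) x = Lp.toTemperedDistribution (𝓕⁻ G : L2Plane) φ := by
    rw [Lp.toTemperedDistribution_apply]
    rfl
  rw [h1, ← Lp.fourierInv_toTemperedDistribution_eq, TemperedDistribution.fourierInv_apply,
    Lp.toTemperedDistribution_apply, SchwartzMap.fourierInv_coe]
  have h2 := VectorFourier.integral_fourierIntegral_smul_eq_flip (L := -innerₗ Plane)
    (f := (φ : Plane → ℂ)) (g := (G : Plane → ℂ))
    Real.continuous_fourierChar continuous_neg_inner (φ.integrable (μ := volume)) hG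
  have h3 : (-innerₗ Plane).flip = -innerₗ Plane := by
    ext x y
    simp [real_inner_comm]
  rw [h3] at h2
  exact h2

/-! ### Frequency cells -/

/-- The plane wave with frequency `(ξ, μ) = 2 π a` at the point `(x, y)`, evolved to time `t`. -/
noncomputable def planeWave (t x y : ℝ) (a : Plane) : ℂ :=
  Complex.exp (Complex.I * ((2 * Real.pi * a 0 * x + 2 * Real.pi * a 1 * y +
    t * dysthePhase (2 * Real.pi * a 0) (2 * Real.pi * a 1) : ℝ) : ℂ))

/-- The `k`-th frequency cell `2^(k+6) ≤ |ξ| < 2^(k+7)`, `|μ| ≤ 2^(k+6) / 8`, in the variable `a`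
with `(ξ, μ) = 2 π a`. The cells are disjoint and cover the support of `χ₁`. -/
def cell (k : ℕ) : Set Plane :=
  {a | (2 ^ (k + 6) ≤ |2 * Real.pi * a 0| ∧ |2 * Real.pi * a 0| < 2 ^ (k + 7)) ∧
    |2 * Real.pi * a 1| ≤ 2 ^ (k + 6) / 8}

lemma norm_planeWave (t x y : ℝ) (a : Plane) : ‖planeWave t x y a‖ = 1 :=
  norm_exp_I_mul_ofReal _

lemma continuous_planeWave : Continuous fun q : (ℝ × ℝ × ℝ) × Plane =>
    planeWave q.1.1 q.1.2.1 q.1.2.2 q.2 := by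
  unfold planeWave dysthePhase
  fun_prop

lemma continuous_planeWave_right (t x y : ℝ) : Continuous (planeWave t x y) :=
  continuous_planeWave.comp (by fun_prop : Continuous fun a : Plane => ((t, x, y), a))

lemma planeWave_mul_conj (t x y t' x' y' : ℝ) (a : Plane) :
    planeWave t x y a * (starRingEnd ℂ) (planeWave t' x' y' a) =
      planeWave (t - t') (x - x') (y - y') a := by
  unfold planeWave
  rw [← Complex.exp_conj, map_mul, Complex.conj_I, Complex.conj_ofReal, ← Complex.exp_add]
  congr 1
  push_cast
  ring

lemma measurableSet_cell (k : ℕ) : MeasurableSet (cell k) := by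
  have h0 : Measurable fun a : Plane => |2 * Real.pi * a 0| := by fun_prop
  have h1 : Measurable fun a : Plane => |2 * Real.pi * a 1| := by fun_prop
  exact ((measurableSet_le measurable_const h0).inter (measurableSet_lt h0 measurable_const)).inter
    (measurableSet_le h1 measurable_const)

lemma disjoint_cell {k l : ℕ} (h : k ≠ l) : Disjoint (cell k) (cell l) := by
  rw [Set.disjoint_left]
  rintro a ⟨⟨h1, h2⟩, -⟩ ⟨⟨h3, h4⟩, -⟩
  have e1 := (pow_lt_pow_iff_right₀ (by norm_num : (1 : ℝ) < 2)).1 (h1.trans_lt h4)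
  have e2 := (pow_lt_pow_iff_right₀ (by norm_num : (1 : ℝ) < 2)).1 (h3.trans_lt h2)
  omega

lemma volume_cell_lt_top (k : ℕ) : volume (cell k) < ⊤ := by
  refine (measure_mono (t := Metric.closedBall 0 (2 ^ (k + 8))) fun a ha => ?_).trans_lt
    measure_closedBall_lt_top
  obtain ⟨⟨-, h2⟩, h3⟩ := ha
  have hpi : (1 : ℝ) ≤ |2 * Real.pi| := by
    rw [abs_of_pos (by positivity)]; linarith [Real.pi_gt_three]
  rw [abs_mul] at h2 h3
  have e0 : |a 0| ≤ 2 ^ (k + 7) := by nlinarith [abs_nonneg (a 0)]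
  have e1 : |a 1| ≤ 2 ^ (k + 7) := by
    have : (2 : ℝ) ^ (k + 7) = 2 * 2 ^ (k + 6) := by ring
    have h4 : (0 : ℝ) < 2 ^ (k + 6) := by positivity
    nlinarith [abs_nonneg (a 1)]
  rw [mem_closedBall_zero_iff, EuclideanSpace.norm_eq, Fin.sum_univ_two, Real.norm_eq_abs,
    Real.norm_eq_abs]
  refine Real.sqrt_le_iff.2 ⟨by positivity, ?_⟩
  have h5 : (2 : ℝ) ^ (k + 8) = 2 * 2 ^ (k + 7) := by ring
  have h6 : (0 : ℝ) < 2 ^ (k + 7) := by positivity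
  rw [h5]
  nlinarith [abs_nonneg (a 0), abs_nonneg (a 1)]

instance (k : ℕ) : IsFiniteMeasure (volume.restrict (cell k)) :=
  ⟨by rw [Measure.restrict_apply_univ]; exact volume_cell_lt_top k⟩

/-- The kernel of a cell with `|ξ|` of size `L` is at most `20 L^{3/2} |x|^{-1/2}`, uniformly in `t`
and `y`: oscillation in `ξ`, and the length of the cell in `μ`. -/
lemma norm_integral_cell_planeWave_le (k : ℕ) (t x y : ℝ) (hx : x ≠ 0) :
    ‖∫ a in cell k, planeWave t x y a‖ ≤ 2 ^ (k + 6) * (20 * √(2 ^ (k + 6) / |x|)) := by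
  set L : ℝ := 2 ^ (k + 6) with hL
  have hL64 : 64 ≤ L := by
    calc (64 : ℝ) = 2 ^ 6 := by norm_num
      _ ≤ 2 ^ (k + 6) := pow_le_pow_right₀ (by norm_num) (by omega)
  have hL2 : (2 : ℝ) ^ (k + 7) = 2 * L := by rw [hL]; ring
  have hpi : 0 < 2 * Real.pi := by positivity
  set S : Set ℝ := {ξ | L ≤ |2 * Real.pi * ξ| ∧ |2 * Real.pi * ξ| < 2 ^ (k + 7)} with hS
  set M : Set ℝ := {μ | |2 * Real.pi * μ| ≤ L / 8} with hM
  set E : ℝ → ℝ → ℂ := fun ξ μ => Complex.exp (Complex.I * ((2 * Real.pi * ξ * x +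
    2 * Real.pi * μ * y + t * dysthePhase (2 * Real.pi * ξ) (2 * Real.pi * μ) : ℝ) : ℂ)) with hE
  have hEc : Continuous (Function.uncurry E) := by
    unfold E dysthePhase Function.uncurry; fun_prop
  have hEn : ∀ ξ μ, ‖E ξ μ‖ = 1 := fun ξ μ => norm_exp_I_mul_ofReal _
  have hMeq : M = Set.Icc (-(L / 8 / (2 * Real.pi))) (L / 8 / (2 * Real.pi)) := by
    ext μ
    rw [Set.mem_Icc, ← abs_le, le_div_iff₀ hpi, hM, Set.mem_ofPred_eq, abs_mul, abs_of_pos hpi,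
      mul_comm]
  have hSeq : S = Set.Ioc (-(2 * L) / (2 * Real.pi)) (-L / (2 * Real.pi)) ∪
      Set.Ico (L / (2 * Real.pi)) (2 * L / (2 * Real.pi)) := by
    ext ξ
    rw [hS, Set.mem_ofPred_eq, Set.mem_union, Set.mem_Ioc, Set.mem_Ico, div_lt_iff₀ hpi,
      le_div_iff₀ hpi, div_le_iff₀ hpi, lt_div_iff₀ hpi, hL2, le_abs, abs_lt]
    rw [mul_comm ξ]
    constructor
    · rintro ⟨h1 | h1, h2, h3⟩
      · exact Or.inr ⟨h1, h3⟩
      · exact Or.inl ⟨h2, by linarith⟩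
    · rintro (⟨h1, h2⟩ | ⟨h1, h2⟩)
      · exact ⟨Or.inr (by linarith), h1, by linarith⟩
      · exact ⟨Or.inl h1, by linarith, h2⟩
  have hcell : cell k = planeEquiv ⁻¹' (S ×ˢ M) := by
    ext a
    simp only [cell, hS, hM, Set.mem_preimage, planeEquiv_apply, Set.mem_prod, Set.mem_ofPred_eq,
      hL]
  have hpl : ∫ a in cell k, planeWave t x y a =
      ∫ q in S ×ˢ M, E q.1 q.2 ∂(volume.prod volume) := by
    rw [hcell, ← measurePreserving_planeEquiv.setIntegral_preimage_emb
      planeEquiv.measurableEmbedding]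
    rfl
  have hSfin : volume S < ⊤ := by
    rw [hSeq]
    exact (measure_union_le _ _).trans_lt (by simp)
  have hMfin : volume M < ⊤ := by rw [hMeq]; simp
  have hint : IntegrableOn (fun q : ℝ × ℝ => E q.1 q.2) (S ×ˢ M) (volume.prod volume) := by
    refine Measure.integrableOn_of_bounded (M := 1) ?_ hEc.aestronglyMeasurable
      (Filter.Eventually.of_forall fun q => (hEn _ _).le)
    rw [Measure.prod_prod]
    exact (ENNReal.mul_lt_top hSfin hMfin).ne
  have hswap : ∫ q in S ×ˢ M, E q.1 q.2 ∂(volume.prod volume) = ∫ μ in M, ∫ ξ in S, E ξ μ := by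
    rw [← Measure.prod_restrict] at *
    rw [integral_prod_symm]
    rw [IntegrableOn, ← Measure.prod_restrict] at hint
    exact hint
  have hinner : ∀ μ ∈ M, ‖∫ ξ in S, E ξ μ‖ ≤ 20 * √(L / |x|) := by
    intro μ hμ
    have hpiece : ∀ a b : ℝ, a ≤ b → ((L ≤ a ∧ b ≤ 4 * L) ∨ (-(4 * L) ≤ a ∧ b ≤ -L)) →
        ‖∫ ξ in (a / (2 * Real.pi))..(b / (2 * Real.pi)), E ξ μ‖ ≤ 10 * √(L / |x|) := by
      intro a b hab hI
      have e1 : ∀ ξ, E ξ μ = Complex.exp (Complex.I * ((2 * Real.pi * μ * y : ℝ) : ℂ)) *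
          (fun ξ => Complex.exp (Complex.I *
            ((ξ * x + t * dysthePhase ξ (2 * Real.pi * μ) : ℝ) : ℂ))) (2 * Real.pi * ξ) := by
        intro ξ
        simp only [hE]
        rw [← Complex.exp_add]
        congr 1
        push_cast
        ring
      have e3 := intervalIntegral.integral_comp_mul_left (a := a / (2 * Real.pi))
        (b := b / (2 * Real.pi)) (fun ξ => Complex.exp (Complex.I *
          ((ξ * x + t * dysthePhase ξ (2 * Real.pi * μ) : ℝ) : ℂ))) hpi.ne'
      simp only [e1]
      rw [intervalIntegral.integral_const_mul, norm_mul, norm_exp_I_mul_ofReal, one_mul,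
        e3, norm_smul, norm_inv, Real.norm_eq_abs,
        abs_of_pos hpi, mul_div_cancel₀ _ hpi.ne', mul_div_cancel₀ _ hpi.ne']
      have e2 := norm_integral_exp_dysthePhase_le (μ := 2 * Real.pi * μ) t x hL64 hμ hab hI hx
      calc (2 * Real.pi)⁻¹ * _ ≤ 6⁻¹ * (60 * √(L / |x|)) := by
            refine mul_le_mul (inv_anti₀ (by norm_num) ?_) e2 (norm_nonneg _) (by norm_num)
            linarith [Real.pi_gt_three]
        _ = 10 * √(L / |x|) := by ring
    have hEi : ∀ T : Set ℝ, volume T < ⊤ → IntegrableOn (fun ξ => E ξ μ) T := fun T hT =>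
      Measure.integrableOn_of_bounded (M := 1) hT.ne
        (hEc.comp (by fun_prop : Continuous fun ξ : ℝ => (ξ, μ))).aestronglyMeasurable
        (Filter.Eventually.of_forall fun q => (hEn _ _).le)
    have hdis : Disjoint (Set.Ioc (-(2 * L) / (2 * Real.pi)) (-L / (2 * Real.pi)))
        (Set.Ico (L / (2 * Real.pi)) (2 * L / (2 * Real.pi))) := by
      rw [Set.disjoint_left]
      intro ξ h1 h2
      have e1 : -L / (2 * Real.pi) < L / (2 * Real.pi) := by gcongr; linarith
      linarith [h1.2, h2.1]
    rw [hSeq, setIntegral_union hdis measurableSet_Ico (hEi _ (by simp)) (hEi _ (by simp)),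
      setIntegral_congr_set (Ico_ae_eq_Ioc (a := L / (2 * Real.pi))),
      ← intervalIntegral.integral_of_le (by gcongr; linarith),
      ← intervalIntegral.integral_of_le (by gcongr; linarith)]
    refine (norm_add_le _ _).trans ((add_le_add (hpiece _ _ (by linarith) (Or.inr ?_))
      (hpiece _ _ (by linarith) (Or.inl ?_))).trans (le_of_eq (by ring)))
    · constructor <;> linarith
    · constructor <;> linarith
  rw [hpl, hswap]
  refine (norm_setIntegral_le_of_norm_le_const hMfin hinner).trans ?_
  rw [mul_comm]
  refine mul_le_mul_of_nonneg_right ?_ (by positivity)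
  rw [hMeq, Real.volume_real_Icc_of_le (by
    have : 0 ≤ L / 8 / (2 * Real.pi) := by positivity
    linarith)]
  have : L / 8 / (2 * Real.pi) ≤ L / 8 := div_le_self (by linarith)
    (by linarith [Real.pi_gt_three])
  linarith

lemma memLp_indicator_conj_planeWave (k : ℕ) (x y : ℝ) :
    MemLp ((cell k).indicator fun a => (starRingEnd ℂ) (planeWave 0 x y a)) 2 volume :=
  (memLp_indicator_iff_restrict (measurableSet_cell k)).2 (MemLp.of_bound
    (Complex.continuous_conj.comp (continuous_planeWave_right 0 x y)).aestronglyMeasurable 1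
    (Filter.Eventually.of_forall fun a => by rw [RCLike.norm_conj, norm_planeWave]))

/-- The part of `V` at frequencies in the `k`-th cell, evaluated at the point `(x, y)`; a continuous
linear functional on `L²`, because the cell has finite measure. -/
noncomputable def cellEval (k : ℕ) (x y : ℝ) : L2Plane →L[ℂ] ℂ :=
  (innerSL ℂ ((memLp_indicator_conj_planeWave k x y).toLp _ : L2Plane)) ∘L
    (Lp.fourierTransformₗᵢ Plane ℂ).toContinuousLinearEquiv.toContinuousLinearMap

lemma cellEval_apply (k : ℕ) (x y : ℝ) (V : L2Plane) :
    cellEval k x y V = ∫ a in cell k, planeWave 0 x y a * (𝓕 V : L2Plane) a := by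
  have h0 : cellEval k x y V =
    inner ℂ ((memLp_indicator_conj_planeWave k x y).toLp _ : L2Plane) (𝓕 V : L2Plane) := rfl
  rw [h0, L2.inner_def, ← integral_indicator (measurableSet_cell k)]
  refine integral_congr_ae ?_
  filter_upwards [(memLp_indicator_conj_planeWave k x y).coeFn_toLp] with a ha
  rw [ha]
  by_cases h : a ∈ cell k
  · simp [h, mul_comm]
  · simp [h]

-- All that is used below is continuity, linearity and `cellEval_apply`.
attribute [irreducible] cellEval

/-! ### The propagator on the Fourier side -/

variable (c : BasicCutoff)

/-- The Fourier transform of `W₁(t) f`, without its time dependence `exp(i t Φ)`. -/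
noncomputable def cutData (f : L2Plane) (a : Plane) : ℂ :=
  ((2 * Real.pi) ^ 2 : ℝ) * ((c.chi1 (2 * Real.pi * a 0) (2 * Real.pi * a 1) : ℂ) *
    (𝓕 f : L2Plane) a)

lemma abs_chi1_le_one (ξ μ : ℝ) : |c.chi1 ξ μ| ≤ 1 := by
  have h := c.norm_symbol1_le 0 ξ μ
  unfold BasicCutoff.symbol1 at h
  rwa [norm_mul, norm_exp_I_mul_ofReal, one_mul, Complex.norm_real, Real.norm_eq_abs] at h

lemma measurable_cutData (f : L2Plane) : Measurable (cutData c f) := by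
  have h := c.measurable_symbol1 0
  simp only [BasicCutoff.symbol1, zero_mul, Complex.ofReal_zero, mul_zero, Complex.exp_zero,
    one_mul] at h
  exact (h.mul (Lp.stronglyMeasurable (𝓕 f : L2Plane)).measurable).const_mul _

lemma norm_cutData_le (f : L2Plane) (a : Plane) :
    ‖cutData c f a‖ ≤ (2 * Real.pi) ^ 2 * ‖(𝓕 f : L2Plane) a‖ := by
  unfold cutData
  rw [norm_mul, norm_mul, Complex.norm_real, Complex.norm_real, Real.norm_eq_abs,
    Real.norm_eq_abs, abs_of_nonneg (by positivity)]
  gcongr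
  exact mul_le_of_le_one_left (norm_nonneg _) (abs_chi1_le_one c _ _)

lemma memLp_cutData (f : L2Plane) : MemLp (cutData c f) 2 volume :=
  (Lp.memLp (𝓕 f : L2Plane)).of_le_mul (measurable_cutData c f).aestronglyMeasurable
    (Filter.Eventually.of_forall (norm_cutData_le c f))

lemma fourier_W1_ae_eq (t : ℝ) (f : L2Plane) :
    (𝓕 (c.W1 t f) : L2Plane) =ᵐ[volume] fun a => planeWave t 0 0 a * cutData c f a := by
  unfold BasicCutoff.W1
  rw [FourierTransform.fourier_smul, FourierTransform.fourier_fourierInv_eq]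
  filter_upwards [Lp.coeFn_smul (((2 * Real.pi) ^ 2 : ℝ) : ℂ)
    ((c.memLp_symbol1_mul t f).toLp _ : L2Plane), (c.memLp_symbol1_mul t f).coeFn_toLp]
    with a h1 h2
  rw [h1, Pi.smul_apply, h2]
  unfold cutData BasicCutoff.symbol1 planeWave
  simp only [mul_zero, zero_add, smul_eq_mul]
  ring

lemma fourier_sub (f h : L2Plane) : 𝓕 (f - h) = 𝓕 f - 𝓕 h :=
  (Lp.fourierTransformₗᵢ Plane ℂ).map_sub f h

lemma norm_W1_sub_le (t : ℝ) (f h : L2Plane) :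
    ‖c.W1 t f - c.W1 t h‖ ≤ (2 * Real.pi) ^ 2 * ‖f - h‖ := by
  rw [← Lp.norm_fourier_eq (c.W1 t f - c.W1 t h), ← Lp.norm_fourier_eq (f - h),
    fourier_sub, fourier_sub]
  refine Lp.norm_le_mul_norm_of_ae_le_mul ?_
  filter_upwards [Lp.coeFn_sub (𝓕 (c.W1 t f)) (𝓕 (c.W1 t h)), Lp.coeFn_sub (𝓕 f) (𝓕 h),
    fourier_W1_ae_eq c t f, fourier_W1_ae_eq c t h] with a h1 h2 h3 h4
  rw [h1, h2, Pi.sub_apply, Pi.sub_apply, h3, h4, ← mul_sub, norm_mul, norm_planeWave, one_mul]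
  unfold cutData
  rw [← mul_sub, ← mul_sub, norm_mul, norm_mul, Complex.norm_real, Complex.norm_real,
    Real.norm_eq_abs, Real.norm_eq_abs, abs_of_nonneg (by positivity)]
  gcongr
  exact mul_le_of_le_one_left (norm_nonneg _) (abs_chi1_le_one c _ _)

lemma norm_W1_le (t : ℝ) (f : L2Plane) : ‖c.W1 t f‖ ≤ (2 * Real.pi) ^ 2 * ‖f‖ := by
  rw [← Lp.norm_fourier_eq (c.W1 t f), ← Lp.norm_fourier_eq f]
  refine Lp.norm_le_mul_norm_of_ae_le_mul ?_
  filter_upwards [fourier_W1_ae_eq c t f] with a h1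
  rw [h1, norm_mul, norm_planeWave, one_mul]
  exact norm_cutData_le c f a

lemma continuous_W1_left (f : L2Plane) : Continuous fun t => c.W1 t f := by
  have h1 : Continuous fun t => (𝓕 (c.W1 t f) : L2Plane) := by
    refine continuous_iff_continuousAt.2 fun t₀ => ?_
    refine tendsto_Lp_two_of_dominated (h := fun a => ‖cutData c f a‖ₑ)
      (fun t => fourier_W1_ae_eq c t f) (fourier_W1_ae_eq c t₀ f)
      (fun t => (continuous_planeWave_right t 0 0).measurable.mul (measurable_cutData c f))
      ((continuous_planeWave_right t₀ 0 0).measurable.mul (measurable_cutData c f)) ?_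
      (fun t a => ?_) (fun a => ?_) (Filter.Eventually.of_forall fun a => ?_)
    · have := lintegral_rpow_enorm_lt_top_of_eLpNorm_lt_top (by norm_num) (by norm_num)
        (memLp_cutData c f).2
      simpa using this.ne
    · rw [enorm_mul, ← ofReal_norm, norm_planeWave, ENNReal.ofReal_one, one_mul]
    · rw [enorm_mul, ← ofReal_norm, norm_planeWave, ENNReal.ofReal_one, one_mul]
    · have h2 : Continuous fun t => planeWave t 0 0 a :=
        continuous_planeWave.comp
          (by fun_prop : Continuous fun t : ℝ => (((t, 0, 0) : ℝ × ℝ × ℝ), a))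
      exact (h2.tendsto t₀).mul_const _
  have h2 : (fun t => c.W1 t f) = fun t => (𝓕⁻ (𝓕 (c.W1 t f) : L2Plane) : L2Plane) := by
    ext1 t
    rw [FourierTransform.fourierInv_fourier_eq]
  rw [h2]
  exact ((Lp.fourierTransformₗᵢ Plane ℂ).symm.continuous).comp h1

lemma continuous_W1 : Continuous fun q : ℝ × L2Plane => c.W1 q.1 q.2 := by
  refine continuous_prod_of_continuous_lipschitzWith' _ (Real.toNNReal ((2 * Real.pi) ^ 2))
    (fun t => LipschitzWith.of_dist_le_mul fun f h => ?_) fun f => continuous_W1_left c f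
  rw [dist_eq_norm, dist_eq_norm, Real.coe_toNNReal _ (by positivity)]
  exact norm_W1_sub_le c t f h

lemma cellEval_W1 (k : ℕ) (t x y : ℝ) (f : L2Plane) :
    cellEval k x y (c.W1 t f) = ∫ a in cell k, planeWave t x y a * cutData c f a := by
  rw [cellEval_apply]
  refine integral_congr_ae (ae_restrict_of_ae ?_)
  filter_upwards [fourier_W1_ae_eq c t f] with a ha
  rw [ha, ← mul_assoc]
  congr 1
  unfold planeWave
  rw [← Complex.exp_add]
  congr 1
  push_cast
  ring

lemma continuous_cellEval_W1 (k : ℕ) (f : L2Plane) :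
    Continuous fun q : ℝ × ℝ × ℝ => cellEval k q.2.1 q.2.2 (c.W1 q.1 f) := by
  simp only [cellEval_W1]
  have hm : MemLp (cutData c f) 2 (volume.restrict (cell k)) := (memLp_cutData c f).restrict _
  refine continuous_of_dominated (bound := fun a => ‖cutData c f a‖) (fun q => ?_) (fun q => ?_)
    (hm.integrable (by norm_num)).norm (Filter.Eventually.of_forall fun a => ?_)
  · exact ((continuous_planeWave_right _ _ _).measurable.mul
      (measurable_cutData c f)).aestronglyMeasurable
  · exact Filter.Eventually.of_forall fun a => by rw [norm_mul, norm_planeWave, one_mul]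
  · exact (continuous_planeWave.comp (by fun_prop : Continuous fun q : ℝ × ℝ × ℝ => (q, a))).mul
      continuous_const

/-- The cells cover the support of the cut-off. -/
lemma cutData_eq_zero (f : L2Plane) {a : Plane} (ha : a ∉ ⋃ k, cell k) : cutData c f a = 0 := by
  suffices h : c.chi1 (2 * Real.pi * a 0) (2 * Real.pi * a 1) = 0 by
    unfold cutData; rw [h]; simp
  by_contra h0
  apply ha
  set ξ := 2 * Real.pi * a 0 with hξ
  set μ := 2 * Real.pi * a 1 with hμ
  have h1 : 100 ≤ |ξ| := by
    by_contra h
    have := c.eq_one ξ (not_le.1 h)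
    unfold BasicCutoff.chi1 at h0
    rw [this] at h0
    simp at h0
  have h2 : 100 * |μ| ≤ |ξ| := by
    by_cases hμ0 : μ = 0
    · rw [hμ0, abs_zero]; linarith
    · by_contra h
      have hpos := abs_pos.2 hμ0
      have := c.eq_one (ξ / μ) (by rw [abs_div, div_lt_iff₀ hpos]; exact not_le.1 h)
      unfold BasicCutoff.chi1 at h0
      rw [this] at h0
      simp [hμ0] at h0
  obtain ⟨k, hk1, hk2⟩ := exists_nat_pow_near (x := |ξ| / 64) (y := 2)
    (by rw [le_div_iff₀ (by norm_num)]; linarith) (by norm_num)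
  rw [le_div_iff₀ (by norm_num)] at hk1
  rw [div_lt_iff₀ (by norm_num)] at hk2
  have e6 : (2 : ℝ) ^ (k + 6) = 2 ^ k * 64 := by rw [pow_add]; norm_num
  have e7 : (2 : ℝ) ^ (k + 7) = 2 ^ (k + 1) * 64 := by rw [pow_add, pow_add]; norm_num; ring
  refine Set.mem_iUnion.2 ⟨k, ⟨e6 ▸ hk1, e7 ▸ hk2⟩, ?_⟩
  have : (2 : ℝ) ^ (k + 1) = 2 * 2 ^ k := by ring
  have hp : (0 : ℝ) < 2 ^ k := by positivity
  rw [e6, ← hμ]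
  linarith

/-- A function whose Fourier transform is carried by the cells is dominated by the sum of its
frequency-localised pieces: partial sums converge in `L²`, so a subsequence converges almost
everywhere. -/
lemma ae_enorm_le_tsum_cellEval {V : L2Plane}
    (hV : ∀ᵐ a ∂(volume : Measure Plane), a ∉ ⋃ k, cell k → (𝓕 V : L2Plane) a = 0) :
    ∀ᵐ p ∂(volume : Measure Plane), ‖V p‖ₑ ≤ ∑' k, ‖cellEval k (p 0) (p 1) V‖ₑ := by
  set h : L2Plane := 𝓕 V with hh
  set S : ℕ → Set Plane := fun n => ⋃ k ∈ Finset.range n, cell k with hS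
  have hSm : ∀ n, MeasurableSet (S n) := fun n =>
    Finset.measurableSet_biUnion _ fun k _ => measurableSet_cell k
  have hSfin : ∀ n, volume (S n) < ⊤ := fun n =>
    measure_biUnion_lt_top (Finset.finite_toSet _) fun k _ => volume_cell_lt_top k
  have hmem : ∀ n, MemLp ((S n).indicator h) 2 volume := fun n => (Lp.memLp h).indicator (hSm n)
  set G : ℕ → L2Plane := fun n => (hmem n).toLp _ with hG
  have hGae : ∀ n, G n =ᵐ[volume] (S n).indicator h := fun n => (hmem n).coeFn_toLp
  have hhm : Measurable h := (Lp.stronglyMeasurable h).measurable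
  have hlim : Filter.Tendsto G Filter.atTop (nhds h) := by
    refine tendsto_Lp_two_of_dominated (h := fun a => ‖h a‖ₑ) hGae
      (g := (⋃ k, cell k).indicator h) ?_ (fun n => hhm.indicator (hSm n))
      (hhm.indicator (MeasurableSet.iUnion measurableSet_cell)) ?_ (fun n a => ?_) (fun a => ?_)
      (Filter.Eventually.of_forall fun a => ?_)
    · filter_upwards [hV] with a ha
      by_cases hc : a ∈ ⋃ k, cell k
      · rw [Set.indicator_of_mem hc]
      · rw [Set.indicator_of_notMem hc, ha hc]
    · rw [← enorm_sq_eq_lintegral]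
      finiteness
    · exact enorm_indicator_le_enorm_self _ _
    · exact enorm_indicator_le_enorm_self _ _
    · exact ((tendsto_indicator_biUnion_finset (fun k => cell k) (fun a => h a) a).comp
        Filter.tendsto_finset_range).mono_right (pure_le_nhds _)
  have hlimV : Filter.Tendsto (fun n => (𝓕⁻ (G n) : L2Plane)) Filter.atTop (nhds V) := by
    have h1 := ((Lp.fourierTransformₗᵢ Plane ℂ).symm.continuous.tendsto h).comp hlim
    have h2 : (Lp.fourierTransformₗᵢ Plane ℂ).symm h = V :=
      (Lp.fourierTransformₗᵢ Plane ℂ).symm_apply_apply V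
    rw [h2] at h1
    exact h1
  obtain ⟨ns, -, hns⟩ := (tendstoInMeasure_of_tendsto_Lp hlimV).exists_seq_tendsto_ae
  have hsum : ∀ n, ∀ᵐ p ∂(volume : Measure Plane),
      (𝓕⁻ (G n) : L2Plane) p = ∑ k ∈ Finset.range n, cellEval k (p 0) (p 1) V := by
    intro n
    have hi : Integrable (G n) volume := by
      refine Integrable.congr ?_ (hGae n).symm
      rw [integrable_indicator_iff (hSm n)]
      have : IsFiniteMeasure (volume.restrict (S n)) :=
        ⟨by rw [Measure.restrict_apply_univ]; exact hSfin n⟩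
      exact ((Lp.memLp h).restrict (S n)).integrable (by norm_num)
    filter_upwards [fourierInv_ae_eq_integral hi] with p hp
    rw [hp, Real.fourierInv_eq']
    have e1 : ∀ v : Plane, Complex.exp (((2 * Real.pi * inner ℝ v p : ℝ) : ℂ) * Complex.I) =
        planeWave 0 (p 0) (p 1) v := by
      intro v
      unfold planeWave
      rw [mul_comm]
      congr 3
      rw [PiLp.inner_apply, Fin.sum_univ_two]
      simp
      ring
    calc _ = ∫ v, (S n).indicator (fun v => planeWave 0 (p 0) (p 1) v * h v) v := by
          refine integral_congr_ae ?_
          filter_upwards [hGae n] with v hv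
          rw [e1, hv, smul_eq_mul]
          by_cases hc : v ∈ S n
          · simp [hc]
          · simp [hc]
      _ = ∫ v in S n, planeWave 0 (p 0) (p 1) v * h v := integral_indicator (hSm n)
      _ = ∑ k ∈ Finset.range n, ∫ v in cell k, planeWave 0 (p 0) (p 1) v * h v := by
          refine integral_biUnion_finset _ (fun k _ => measurableSet_cell k)
            (fun k _ l _ hkl => disjoint_cell hkl) fun k _ => ?_
          have h3 : Integrable h (volume.restrict (cell k)) :=
            ((Lp.memLp h).restrict (cell k)).integrable (by norm_num)
          exact h3.bdd_mul (c := 1) (continuous_planeWave_right _ _ _).aestronglyMeasurable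
            (Filter.Eventually.of_forall fun a => (norm_planeWave _ _ _ _).le)
      _ = _ := Finset.sum_congr rfl fun k _ => (cellEval_apply k _ _ V).symm
  filter_upwards [hns, ae_all_iff.2 hsum] with p h1 h2
  refine le_of_tendsto' h1.enorm fun i => ?_
  rw [h2]
  exact (enorm_sum_le _ _).trans (ENNReal.sum_le_tsum _)

/-! ### The maximal function of a frequency cell -/

/-- A dense sequence of parameters `(t, y)`. -/
@[irreducible]
noncomputable def paramSeq : ℕ → ℝ × ℝ := TopologicalSpace.denseSeq (ℝ × ℝ)

lemma denseRange_paramSeq : DenseRange paramSeq := by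
  unfold paramSeq
  exact TopologicalSpace.denseRange_denseSeq (ℝ × ℝ)

/-- The supremum over all `t` and `y` of the part of `W₁(t) f` in the `k`-th cell, taken over a
dense sequence of parameters; by continuity this loses nothing (`enorm_cellEval_W1_le`). -/
noncomputable def cellMax (k : ℕ) (f : L2Plane) (x : ℝ) : ℝ≥0∞ :=
  ⨆ n, ‖cellEval k x (paramSeq n).2 (c.W1 (paramSeq n).1 f)‖ₑ

lemma enorm_cellEval_W1_le (k : ℕ) (t x y : ℝ) (f : L2Plane) :
    ‖cellEval k x y (c.W1 t f)‖ₑ ≤ cellMax c k f x := by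
  have hc : Continuous fun z : ℝ × ℝ => ‖cellEval k x z.2 (c.W1 z.1 f)‖ₑ :=
    ((continuous_cellEval_W1 c k f).comp
      (by fun_prop : Continuous fun z : ℝ × ℝ => (z.1, x, z.2))).enorm
  have h1 : ∀ z : ℝ × ℝ, ‖cellEval k x z.2 (c.W1 z.1 f)‖ₑ ≤ cellMax c k f x := fun z =>
    denseRange_paramSeq.induction_on
      (p := fun z : ℝ × ℝ => ‖cellEval k x z.2 (c.W1 z.1 f)‖ₑ ≤ cellMax c k f x) z
      (isClosed_le hc continuous_const) fun n => by
        unfold cellMax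
        exact le_iSup (fun n => ‖cellEval k x (paramSeq n).2 (c.W1 (paramSeq n).1 f)‖ₑ) n
  exact h1 (t, y)

lemma measurable_cellEval_W1 {F : ℝ → L2Plane} (hF : StronglyMeasurable F) (k : ℕ) (t y : ℝ) :
    Measurable fun q : ℝ × ℝ => cellEval k q.2 y (c.W1 t (F q.1)) := by
  have hx : ∀ t' : ℝ, Continuous fun x : ℝ => cellEval k x y (c.W1 t (F t')) := fun t' =>
    (continuous_cellEval_W1 c k (F t')).comp (by fun_prop : Continuous fun x : ℝ => (t, x, y))
  have hW : Continuous fun f : L2Plane => c.W1 t f := by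
    have h := continuous_W1 c
    fun_prop
  have hWF : StronglyMeasurable fun t' => c.W1 t (F t') := hW.comp_stronglyMeasurable hF
  have ht : ∀ x : ℝ, StronglyMeasurable fun t' : ℝ => cellEval k x y (c.W1 t (F t')) := fun x =>
    (cellEval k x y).continuous.comp_stronglyMeasurable hWF
  have h1 := stronglyMeasurable_uncurry_of_continuous_of_stronglyMeasurable
    (u := fun (x t' : ℝ) => cellEval k x y (c.W1 t (F t'))) hx ht
  have h2 := h1.measurable.comp measurable_swap
  exact h2

lemma measurable_cellMax {F : ℝ → L2Plane} (hF : StronglyMeasurable F) (k : ℕ) :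
    Measurable fun q : ℝ × ℝ => cellMax c k (F q.1) q.2 := by
  unfold cellMax
  exact Measurable.iSup fun n => (measurable_cellEval_W1 c hF k _ _).enorm

lemma measurable_cellMax_right (k : ℕ) (f : L2Plane) : Measurable (cellMax c k f) := by
  have hf : StronglyMeasurable fun _ : ℝ => f := stronglyMeasurable_const
  have h1 := measurable_cellMax c hf k
  have h2 : Measurable fun x : ℝ => ((0 : ℝ), x) := measurable_prodMk_left
  have h3 := h1.comp h2
  exact h3

/-- The Fourier transform of `f`, restricted to a cell. -/
noncomputable def cellRestrict (k : ℕ) : L2Plane →L[ℂ] Lp ℂ 2 (volume.restrict (cell k)) :=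
  (LpToLpRestrictCLM Plane ℂ ℂ volume 2 (cell k)) ∘L
    (Lp.fourierTransformₗᵢ Plane ℂ).toContinuousLinearEquiv.toContinuousLinearMap

lemma cellRestrict_ae_eq (k : ℕ) (f : L2Plane) :
    cellRestrict k f =ᵐ[volume.restrict (cell k)] (𝓕 f : L2Plane) :=
  LpToLpRestrictCLM_coeFn ℂ (cell k) (𝓕 f : L2Plane)

lemma enorm_cellRestrict_sq (k : ℕ) (f : L2Plane) :
    ‖cellRestrict k f‖ₑ ^ 2 = ∫⁻ a in cell k, ‖(𝓕 f : L2Plane) a‖ₑ ^ 2 := by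
  rw [enorm_sq_eq_lintegral]
  refine lintegral_congr_ae ?_
  filter_upwards [cellRestrict_ae_eq k f] with a ha
  rw [ha]

/-- The size `2^(k+6)` of the frequencies in the `k`-th cell. -/
noncomputable def cellFreq (k : ℕ) : ℝ≥0 := 2 ^ (k + 6)

/-- The bound for the `L⁴` norm of `cellMax`, of size `2^(3k/4)` times the `L²` norm of the part of
`f` in the cell. The constant comes from `(12 * 20)^(1/2) * 40 ≤ 640`, where `20` belongs to the
kernel of the cell, `12` to fractional integration, and `40` bounds the factor `(2 π)²` of `W₁`. -/
noncomputable def cellBound (k : ℕ) (f : L2Plane) : ℝ≥0 :=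
  640 * cellFreq k ^ (3 / 4 : ℝ) * ‖cellRestrict k f‖₊

lemma measurable_cellBound {F : ℝ → L2Plane} (hF : StronglyMeasurable F) (k : ℕ) :
    Measurable fun t => cellBound k (F t) :=
  (((cellRestrict k).continuous.comp_stronglyMeasurable hF).nnnorm.measurable).const_mul _

lemma lintegral_cellMax_pow_le (k : ℕ) (f : L2Plane) :
    ∫⁻ x, cellMax c k f x ^ 4 ≤ (cellBound k f : ℝ≥0∞) ^ 4 := by
  set L : ℝ≥0 := cellFreq k with hL
  have hL0 : 0 < L := by rw [hL, cellFreq]; positivity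
  have hLr : (L : ℝ) = 2 ^ (k + 6) := by rw [hL, cellFreq]; push_cast; rfl
  set B : ℝ≥0 := 20 * L ^ (3 / 2 : ℝ) with hB
  have hB0 : 0 < B := by positivity
  have hker : ∀ n m x x', x ≠ x' →
      ‖∫ a in cell k, planeWave (paramSeq n).1 x
          (paramSeq n).2 a *
        (starRingEnd ℂ) (planeWave (paramSeq m).1 x'
          (paramSeq m).2 a)‖ₑ ≤
      B * ‖x - x'‖ₑ ^ (-(1 / 2) : ℝ) := by
    intro n m x x' hx
    simp only [planeWave_mul_conj]
    have hx' : x - x' ≠ 0 := sub_ne_zero.2 hx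
    have hxp : 0 < |x - x'| := abs_pos.2 hx'
    have h1 := norm_integral_cell_planeWave_le k ((paramSeq n).1 -
      (paramSeq m).1) (x - x')
      ((paramSeq n).2 - (paramSeq m).2) hx'
    rw [← hLr] at h1
    have h2 : (L : ℝ) * (20 * √(L / |x - x'|)) = (B : ℝ) * |x - x'| ^ (-(1 / 2) : ℝ) := by
      rw [hB, Real.sqrt_div (by positivity), Real.rpow_neg hxp.le, ← Real.sqrt_eq_rpow]
      push_cast
      rw [show (3 / 2 : ℝ) = 1 + 1 / 2 by norm_num, Real.rpow_add (by exact_mod_cast hL0),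
        Real.rpow_one, ← Real.sqrt_eq_rpow]
      ring
    rw [h2] at h1
    rw [← ofReal_norm, ← ofReal_norm (x - x'), Real.norm_eq_abs,
      ENNReal.ofReal_rpow_of_pos hxp, ← ENNReal.ofReal_coe_nnreal,
      ← ENNReal.ofReal_mul (by positivity)]
    exact ENNReal.ofReal_le_ofReal h1
  have hmain := lintegral_iSup_enorm_integral_mul_pow_le
    (e := fun n x a => planeWave (paramSeq n).1 x
      (paramSeq n).2 a) (κ := volume.restrict (cell k))
    (fun n => (continuous_planeWave.comp (by fun_prop : Continuous fun q : ℝ × Plane =>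
      (((paramSeq n).1, q.1, (paramSeq n).2),
        q.2))).measurable)
    (fun n x a => (norm_planeWave _ _ _ _).le) ((memLp_cutData c f).restrict (cell k)) hB0 hker
  simp only [← cellEval_W1] at hmain
  refine hmain.trans ?_
  have hcut : ∫⁻ a in cell k, ‖cutData c f a‖ₑ ^ 2 ≤ (40 * ‖cellRestrict k f‖ₑ) ^ 2 := by
    rw [mul_pow, enorm_cellRestrict_sq, ← lintegral_const_mul' _ _ (by norm_num)]
    refine lintegral_mono fun a => ?_
    rw [← mul_pow]
    gcongr
    rw [← ofReal_norm, ← ofReal_norm, ← ENNReal.ofReal_ofNat, ← ENNReal.ofReal_mul (by norm_num)]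
    refine ENNReal.ofReal_le_ofReal ((norm_cutData_le c f a).trans ?_)
    gcongr
    nlinarith [Real.pi_lt_d2, Real.pi_pos]
  calc (12 * (B : ℝ≥0∞)) ^ 2 * (∫⁻ a in cell k, ‖cutData c f a‖ₑ ^ 2) ^ 2
      ≤ (12 * (B : ℝ≥0∞)) ^ 2 * ((40 * ‖cellRestrict k f‖ₑ) ^ 2) ^ 2 := by gcongr
    _ = (((12 * B) ^ 2 * ((40 * ‖cellRestrict k f‖₊) ^ 2) ^ 2 : ℝ≥0) : ℝ≥0∞) := by
        rw [enorm_eq_nnnorm]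
        push_cast
        rfl
    _ ≤ ((cellBound k f ^ 4 : ℝ≥0) : ℝ≥0∞) := by
        refine ENNReal.coe_le_coe.2 ?_
        have h3 : L ^ (3 / 2 : ℝ) = (L ^ (3 / 4 : ℝ)) ^ 2 := by
          rw [← NNReal.rpow_natCast, ← NNReal.rpow_mul]; norm_num
        rw [hB, h3, cellBound, ← hL]
        calc _ = (240 ^ 2 * 40 ^ 4 : ℝ≥0) * (L ^ (3 / 4 : ℝ) * ‖cellRestrict k f‖₊) ^ 4 := by ring
          _ ≤ 640 ^ 4 * (L ^ (3 / 4 : ℝ) * ‖cellRestrict k f‖₊) ^ 4 := by gcongr; norm_num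
          _ = _ := by ring
    _ = _ := by push_cast; rfl

lemma cellMax_eq_zero {k : ℕ} {f : L2Plane} (h : cellBound k f = 0) (x : ℝ) :
    cellMax c k f x = 0 := by
  have hf : cellRestrict k f = 0 := by
    have hL : cellFreq k ^ (3 / 4 : ℝ) ≠ 0 := by
      have : 0 < cellFreq k := by unfold cellFreq; positivity
      positivity
    simpa [cellBound, hL] using h
  have h0 : ∀ᵐ a ∂(volume.restrict (cell k)), cutData c f a = 0 := by
    have h1 := cellRestrict_ae_eq k f
    rw [hf] at h1
    filter_upwards [h1, Lp.coeFn_zero ℂ 2 (volume.restrict (cell k))] with a h2 h3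
    rw [h3, Pi.zero_apply] at h2
    unfold cutData
    rw [← h2, mul_zero, mul_zero]
  unfold cellMax
  simp only [cellEval_W1, ENNReal.iSup_eq_zero]
  intro n
  rw [integral_eq_zero_of_ae, enorm_zero]
  filter_upwards [h0] with a ha
  rw [ha, mul_zero, Pi.zero_apply]

-- Unfolding the supremum is never needed below, and is costly for the elaborator.
attribute [irreducible] cellMax

/-! ### Sobolev norms -/

lemma enorm_cellRestrict_le_sobolevNorm {s : ℝ} (hs : 0 ≤ s) (k : ℕ) (f : L2Plane) :
    (cellFreq k : ℝ≥0∞) ^ s * ‖cellRestrict k f‖ₑ ≤ sobolevNorm s f := by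
  have h1 : ((cellFreq k : ℝ≥0∞) ^ s * ‖cellRestrict k f‖ₑ) ^ 2 ≤ sobolevNorm s f ^ 2 := by
    unfold sobolevNorm
    rw [eLpNorm_eq_lintegral_rpow_enorm_toReal (by norm_num) (by norm_num),
      ← ENNReal.rpow_natCast (_ ^ (_ : ℝ)), ← ENNReal.rpow_mul, mul_pow, enorm_cellRestrict_sq]
    have h2 : (1 / ENNReal.toReal 2 * ((2 : ℕ) : ℝ)) = 1 := by norm_num
    rw [h2, ENNReal.rpow_one, ENNReal.toReal_ofNat]
    simp only [ENNReal.rpow_two, enorm_mul]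
    rw [← lintegral_const_mul' _ _ (by finiteness)]
    refine le_trans (setLIntegral_mono' (measurableSet_cell k) fun a ha => ?_)
      (setLIntegral_le_lintegral (cell k) _)
    rw [mul_pow]
    gcongr
    rw [← ofReal_norm, Complex.norm_real, Real.norm_of_nonneg (by positivity),
      ← ENNReal.ofReal_coe_nnreal,
      ENNReal.ofReal_rpow_of_nonneg (by positivity) hs]
    refine ENNReal.ofReal_le_ofReal (Real.rpow_le_rpow (by positivity) ?_ hs)
    have h2 := ha.1.1
    have h3 : (cellFreq k : ℝ) = 2 ^ (k + 6) := by rw [cellFreq]; push_cast; rfl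
    rw [h3]
    linarith [abs_nonneg (2 * Real.pi * a 1)]
  exact (ENNReal.pow_le_pow_left_iff (by norm_num)).1 h1

lemma enorm_le_sobolevNorm {s : ℝ} (hs : 0 ≤ s) (f : L2Plane) : ‖f‖ₑ ≤ sobolevNorm s f := by
  have h1 : ‖f‖ₑ = ‖(𝓕 f : L2Plane)‖ₑ := by
    rw [← ofReal_norm, ← ofReal_norm, Lp.norm_fourier_eq]
  rw [h1, Lp.enorm_def]
  refine eLpNorm_mono_enorm fun a => ?_
  rw [enorm_mul]
  refine le_mul_of_one_le_left (by positivity) ?_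
  rw [← ofReal_norm, Complex.norm_real, Real.norm_of_nonneg (by positivity), ENNReal.one_le_ofReal]
  refine Real.one_le_rpow ?_ hs
  linarith [abs_nonneg (2 * Real.pi * a 0), abs_nonneg (2 * Real.pi * a 1)]

/-- The cell bounds are summable against the Sobolev norm of order `s > 3 / 4`. -/
lemma exists_tsum_cellBound_le {s : ℝ} (hs : 3 / 4 < s) : ∃ D : ℕ → ℝ≥0, Summable D ∧
    ∀ k f, (cellBound k f : ℝ≥0∞) ≤ D k * sobolevNorm s f := by
  refine ⟨fun k => 640 * cellFreq k ^ (3 / 4 - s), ?_, fun k f => ?_⟩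
  · refine Summable.mul_left _ ?_
    set r : ℝ≥0 := 2 ^ (3 / 4 - s) with hr
    have hr1 : r < 1 := NNReal.rpow_lt_one_of_one_lt_of_neg (by norm_num) (by linarith)
    have h1 : ∀ k, cellFreq k ^ (3 / 4 - s) = r ^ (k + 6) := fun k => by
      rw [cellFreq, hr, ← NNReal.rpow_natCast, ← NNReal.rpow_natCast, ← NNReal.rpow_mul,
        ← NNReal.rpow_mul, mul_comm]
    have h2 : Summable fun k : ℕ => r ^ k := NNReal.summable_geometric hr1
    rw [show (fun k => cellFreq k ^ (3 / 4 - s)) = fun k => r ^ (k + 6) from funext h1]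
    exact (NNReal.summable_nat_add_iff 6).2 h2
  · have hL : cellFreq k ≠ 0 := by unfold cellFreq; positivity
    have h2 := enorm_cellRestrict_le_sobolevNorm (by linarith : 0 ≤ s) k f
    have h3 : cellFreq k ^ (3 / 4 : ℝ) = cellFreq k ^ (3 / 4 - s) * cellFreq k ^ s := by
      rw [← NNReal.rpow_add hL]; norm_num
    unfold cellBound
    rw [h3]
    push_cast
    calc _ = 640 * ((cellFreq k ^ (3 / 4 - s) : ℝ≥0) : ℝ≥0∞) *
          ((cellFreq k : ℝ≥0∞) ^ s * ‖cellRestrict k f‖ₑ) := by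
          rw [ENNReal.coe_rpow_of_ne_zero hL s, enorm_eq_nnnorm]; ring
      _ ≤ _ := by gcongr

/-! ### Bounds for the lateral norm -/

/-- A family in `L²` which at almost every time is dominated by a function of `x` alone has a
lateral norm at most the `L⁴` norm of that function. -/
lemma lateralNorm_le_of_ae_le {J : Set ℝ} {U : ℝ → L2Plane} {u : ℝ → ℝ → ℝ → ℂ} {M : ℝ → ℝ≥0∞}
    {K : ℝ≥0∞} (hM : Measurable M) (hu : Represents J U u)
    (hUM : ∀ᵐ t ∂(volume.restrict J), ∀ᵐ p ∂(volume : Measure Plane), ‖U t p‖ₑ ≤ M (p 0))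
    (hK : ∫⁻ x, M x ^ 4 ≤ K ^ 4) : lateralNorm 4 ⊤ J u ≤ K := by
  have hS : MeasurableSet {q : ℝ × ℝ × ℝ | ‖u q.1 q.2.1 q.2.2‖ₑ ≤ M q.2.1} :=
    measurableSet_le hu.1.enorm (hM.comp (measurable_fst.comp measurable_snd))
  have h1 : ∀ᵐ t ∂(volume.restrict J), ∀ᵐ q ∂((volume : Measure ℝ).prod (volume : Measure ℝ)),
      ‖u t q.1 q.2‖ₑ ≤ M q.1 := by
    filter_upwards [hUM, hu.2] with t h2 h3
    rw [← measurePreserving_planeEquiv.map_eq, planeEquiv.measurableEmbedding.ae_map_iff]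
    filter_upwards [h2, h3] with p h4 h5
    rw [planeEquiv_apply]
    exact (congrArg enorm h5).trans_le h4
  rw [Measure.ae_ae_comm (p := fun t (q : ℝ × ℝ) => ‖u t q.1 q.2‖ₑ ≤ M q.1) hS] at h1
  have h2 : ∀ᵐ x : ℝ, eLpNorm (fun z : ℝ × ℝ => u z.1 x z.2) ⊤
      ((volume.restrict J).prod volume) ≤ M x := by
    filter_upwards [Measure.ae_ae_of_ae_prod h1] with x hx
    have hSx : MeasurableSet {z : ℝ × ℝ | ‖u z.1 x z.2‖ₑ ≤ M x} :=
      hS.preimage (by fun_prop : Measurable fun z : ℝ × ℝ => (z.1, x, z.2))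
    have hSx' : MeasurableSet {z : ℝ × ℝ | ‖u z.2 x z.1‖ₑ ≤ M x} := hSx.preimage measurable_swap
    rw [Measure.ae_ae_comm (p := fun y t => ‖u t x y‖ₑ ≤ M x) hSx',
      ← Measure.ae_prod_iff_ae_ae (p := fun z : ℝ × ℝ => ‖u z.1 x z.2‖ₑ ≤ M x) hSx] at hx
    rw [eLpNorm_exponent_top]
    exact essSup_le_of_ae_le _ hx
  calc lateralNorm 4 ⊤ J u ≤ eLpNorm M 4 volume := eLpNorm_mono_enorm_ae h2
    _ = (∫⁻ x, M x ^ 4) ^ (1 / 4 : ℝ) := by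
      rw [eLpNorm_eq_lintegral_rpow_enorm_toReal (by norm_num) (by norm_num)]
      simp only [enorm_eq_self, ENNReal.toReal_ofNat]
      norm_cast
    _ ≤ (K ^ 4) ^ (1 / 4 : ℝ) := by gcongr
    _ = K := by
      rw [← ENNReal.rpow_natCast, ← ENNReal.rpow_mul]
      norm_num

/-- Minkowski's inequality on `ℕ × ℝ`, for the maximal functions of all cells and all data `F t`,
combined with the summable Sobolev bounds. The homogeneous estimate is the case of a Dirac
measure `τ`. -/
lemma lintegral_tsum_lintegral_cellMax_pow_le {s : ℝ} {D : ℕ → ℝ≥0} (hD : Summable D)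
    (hDs : ∀ k f, (cellBound k f : ℝ≥0∞) ≤ D k * sobolevNorm s f) {F : ℝ → L2Plane}
    (hF : StronglyMeasurable F) (τ : Measure ℝ) [SFinite τ] :
    ∫⁻ x, (∑' k, ∫⁻ t, cellMax c k (F t) x ∂τ) ^ 4 ≤
      (((∑' k, D k : ℝ≥0) : ℝ≥0∞) * ∫⁻ t, sobolevNorm s (F t) ∂τ) ^ 4 := by
  have hm : Measurable fun q : ℕ × (ℝ × ℝ) => cellMax c q.1 (F q.2.1) q.2.2 :=
    measurable_from_prod_countable_right fun k => measurable_cellMax c hF k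
  have hassoc : Measurable fun q : (ℕ × ℝ) × ℝ => (q.1.1, q.1.2, q.2) := by fun_prop
  have hm' := hm.comp hassoc
  have hw : Measurable fun q : ℕ × ℝ => cellBound q.1 (F q.2) :=
    measurable_from_prod_countable_right fun k => measurable_cellBound hF k
  have h1 := lintegral_lintegral_pow_four_le (ρ := Measure.count.prod τ) (m := volume)
    (f := fun q x => cellMax c q.1 (F q.2) x) hm' hw
    (fun q hq x => cellMax_eq_zero c hq x) (fun q => lintegral_cellMax_pow_le c q.1 (F q.2))
  have h2 : ∀ x, ∫⁻ q, cellMax c q.1 (F q.2) x ∂(Measure.count.prod τ) =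
      ∑' k, ∫⁻ t, cellMax c k (F t) x ∂τ := fun x => by
    have h3 : Measurable fun q : ℕ × ℝ => cellMax c q.1 (F q.2) x :=
      hm'.comp (measurable_prodMk_right (y := x))
    rw [lintegral_prod _ h3.aemeasurable, lintegral_count]
  simp only [h2] at h1
  refine h1.trans ?_
  gcongr
  rw [lintegral_prod _ hw.coe_nnreal_ennreal.aemeasurable, lintegral_count, ENNReal.coe_tsum hD,
    ← ENNReal.tsum_mul_right]
  refine ENNReal.tsum_le_tsum fun k => ?_
  rw [← lintegral_const_mul' _ _ ENNReal.coe_ne_top]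
  exact lintegral_mono fun t => hDs k (F t)

lemma fourier_W1_eq_zero (t : ℝ) (f : L2Plane) :
    ∀ᵐ a ∂(volume : Measure Plane), a ∉ ⋃ k, cell k → (𝓕 (c.W1 t f) : L2Plane) a = 0 := by
  filter_upwards [fourier_W1_ae_eq c t f] with a h1 h2
  rw [h1, cutData_eq_zero c f h2, mul_zero]

/-! ### The homogeneous estimate -/

theorem lateralNorm_W1_le {s : ℝ} {D : ℕ → ℝ≥0} (hD : Summable D)
    (hDs : ∀ k f, (cellBound k f : ℝ≥0∞) ≤ D k * sobolevNorm s f) (f : L2Plane) {J : Set ℝ}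
    {u : ℝ → ℝ → ℝ → ℂ} (hu : Represents J (fun t => c.W1 t f) u) :
    lateralNorm 4 ⊤ J u ≤ ((∑' k, D k : ℝ≥0) : ℝ≥0∞) * sobolevNorm s f := by
  refine lateralNorm_le_of_ae_le (M := fun x => ∑' k, cellMax c k f x)
    (Measurable.tsum fun k => measurable_cellMax_right c k f) hu
    (Filter.Eventually.of_forall fun t => ?_) ?_
  · filter_upwards [ae_enorm_le_tsum_cellEval (fourier_W1_eq_zero c t f)] with p hp
    exact hp.trans (ENNReal.tsum_le_tsum fun k => enorm_cellEval_W1_le c k t _ _ f)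
  · have h := lintegral_tsum_lintegral_cellMax_pow_le c hD hDs
      (F := fun _ => f) stronglyMeasurable_const (Measure.dirac 0)
    simpa only [lintegral_const, measure_univ, mul_one] using h

lemma exists_represents_W1 (f : L2Plane) (J : Set ℝ) :
    ∃ u, Represents J (fun t => c.W1 t f) u :=
  exists_represents (continuous_W1_left c f).aestronglyMeasurable

/-! ### The inhomogeneous estimate -/

lemma aestronglyMeasurable_W1 {F : ℝ → L2Plane} {τ : Measure ℝ} (hF : AEStronglyMeasurable F τ)
    (t : ℝ) : AEStronglyMeasurable (fun t' => c.W1 (t - t') (F t')) τ := by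
  have h1 : AEStronglyMeasurable (fun t' => (t - t', F t')) τ :=
    (by fun_prop : Continuous fun t' : ℝ => t - t').aestronglyMeasurable.prodMk hF
  have h2 := (continuous_W1 c).comp_aestronglyMeasurable h1
  exact h2

lemma integrable_W1 {F : ℝ → L2Plane} {τ : Measure ℝ} (hF : Integrable F τ) (t : ℝ) :
    Integrable (fun t' => c.W1 (t - t') (F t')) τ :=
  (hF.norm.const_mul ((2 * Real.pi) ^ 2)).mono' (aestronglyMeasurable_W1 c hF.1 t)
    (Filter.Eventually.of_forall fun t' => norm_W1_le c (t - t') (F t'))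

lemma integrable_of_lintegral_sobolevNorm_lt_top {s : ℝ} (hs : 0 ≤ s) {F : ℝ → L2Plane}
    {τ : Measure ℝ} (hF : AEStronglyMeasurable F τ) (hFs : ∫⁻ t, sobolevNorm s (F t) ∂τ < ⊤) :
    Integrable F τ :=
  ⟨hF, (lintegral_mono fun t => enorm_le_sobolevNorm hs (F t)).trans_lt hFs⟩

/-- The Duhamel integral has its frequencies in the cells, because restriction of the Fourier
transform to the complement of the cells is a continuous linear map and commutes with the
integral. -/
lemma fourier_integral_W1_eq_zero {F : ℝ → L2Plane} {τ : Measure ℝ} (hF : Integrable F τ) (t : ℝ) :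
    ∀ᵐ a ∂(volume : Measure Plane), a ∉ ⋃ k, cell k →
      (𝓕 (∫ t', c.W1 (t - t') (F t') ∂τ) : L2Plane) a = 0 := by
  set Z : Set Plane := (⋃ k, cell k)ᶜ with hZ
  have hZm : MeasurableSet Z := (MeasurableSet.iUnion measurableSet_cell).compl
  set R : L2Plane →L[ℂ] Lp ℂ 2 (volume.restrict Z) := (LpToLpRestrictCLM Plane ℂ ℂ volume 2 Z) ∘L
    (Lp.fourierTransformₗᵢ Plane ℂ).toContinuousLinearEquiv.toContinuousLinearMap with hR
  have hRae : ∀ V : L2Plane, R V =ᵐ[volume.restrict Z] (𝓕 V : L2Plane) := fun V =>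
    LpToLpRestrictCLM_coeFn ℂ Z (𝓕 V : L2Plane)
  have hRW : ∀ t' : ℝ, R (c.W1 (t - t') (F t')) = 0 := fun t' => by
    refine Lp.ext ?_
    filter_upwards [hRae (c.W1 (t - t') (F t')), Lp.coeFn_zero ℂ 2 (volume.restrict Z),
      ae_restrict_of_ae (fourier_W1_eq_zero c (t - t') (F t')), ae_restrict_mem hZm]
      with a h1 h2 h3 h4
    rw [h1, h2, h3 h4, Pi.zero_apply]
  have hRV : R (∫ t', c.W1 (t - t') (F t') ∂τ) = 0 := by
    rw [← R.integral_comp_comm (integrable_W1 c hF t)]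
    simp only [hRW, integral_zero]
  have h1 := hRae (∫ t', c.W1 (t - t') (F t') ∂τ)
  rw [hRV] at h1
  have h2 : ∀ᵐ a ∂(volume.restrict Z), (𝓕 (∫ t', c.W1 (t - t') (F t') ∂τ) : L2Plane) a = 0 := by
    filter_upwards [h1, Lp.coeFn_zero ℂ 2 (volume.restrict Z)] with a h3 h4
    rw [← h3, h4, Pi.zero_apply]
  exact (ae_restrict_iff' hZm).1 h2

lemma enorm_cellEval_integral_W1_le {F : ℝ → L2Plane} {τ : Measure ℝ} (hF : Integrable F τ)
    (k : ℕ) (t x y : ℝ) :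
    ‖cellEval k x y (∫ t', c.W1 (t - t') (F t') ∂τ)‖ₑ ≤ ∫⁻ t', cellMax c k (F t') x ∂τ := by
  rw [← (cellEval k x y).integral_comp_comm (integrable_W1 c hF t)]
  exact (enorm_integral_le_lintegral_enorm _).trans
    (lintegral_mono fun t' => enorm_cellEval_W1_le c k (t - t') x y (F t'))

lemma exists_represents_duhamel {F : ℝ → L2Plane} {T : ℝ}
    (hF : AEStronglyMeasurable F (volume.restrict (Set.Icc 0 T))) :
    ∃ v, Represents (Set.Icc 0 T) (fun t => ∫ t' in (0 : ℝ)..t, c.W1 (t - t') (F t')) v := by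
  refine exists_represents ?_
  have hG : StronglyMeasurable fun q : ℝ × ℝ => c.W1 (q.1 - q.2) (hF.mk F q.2) := by
    have h1 : StronglyMeasurable fun q : ℝ × ℝ => (q.1 - q.2, hF.mk F q.2) :=
      (by fun_prop : Continuous fun q : ℝ × ℝ => q.1 - q.2).stronglyMeasurable.prodMk
        (hF.stronglyMeasurable_mk.comp_measurable measurable_snd)
    have h2 := (continuous_W1 c).comp_stronglyMeasurable h1
    exact h2
  set S : Set (ℝ × ℝ) := {q | 0 < q.2 ∧ q.2 ≤ q.1}
  have hS : MeasurableSet S :=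
    (measurableSet_lt measurable_const measurable_snd).inter
      (measurableSet_le measurable_snd measurable_fst)
  have hV := (hG.indicator hS).integral_prod_right' (ν := (volume : Measure ℝ))
  refine hV.aestronglyMeasurable.congr ?_
  filter_upwards [ae_restrict_mem measurableSet_Icc] with t ht
  rw [intervalIntegral.integral_of_le ht.1, ← integral_indicator measurableSet_Ioc]
  have hae := (ae_restrict_iff' measurableSet_Icc).1 hF.ae_eq_mk
  refine integral_congr_ae ?_
  filter_upwards [hae] with t' ht'
  by_cases h : t' ∈ Set.Ioc 0 t
  · rw [Set.indicator_of_mem h, Set.indicator_of_mem (show (t, t') ∈ S from h),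
      ht' ⟨h.1.le, h.2.trans ht.2⟩]
  · rw [Set.indicator_of_notMem h, Set.indicator_of_notMem (show (t, t') ∉ S from h)]

theorem lateralNorm_duhamel_le {s : ℝ} (hs : 0 ≤ s) {D : ℕ → ℝ≥0} (hD : Summable D)
    (hDs : ∀ k f, (cellBound k f : ℝ≥0∞) ≤ D k * sobolevNorm s f) {F : ℝ → L2Plane} {T : ℝ}
    (hF : AEStronglyMeasurable F (volume.restrict (Set.Icc 0 T)))
    (hFs : ∫⁻ t in Set.Icc 0 T, sobolevNorm s (F t) < ⊤) {v : ℝ → ℝ → ℝ → ℂ}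
    (hv : Represents (Set.Icc 0 T) (fun t => ∫ t' in (0 : ℝ)..t, c.W1 (t - t') (F t')) v) :
    lateralNorm 4 ⊤ (Set.Icc 0 T) v ≤
      ((∑' k, D k : ℝ≥0) : ℝ≥0∞) * ∫⁻ t in Set.Icc 0 T, sobolevNorm s (F t) := by
  have hFi := integrable_of_lintegral_sobolevNorm_lt_top hs hF hFs
  have hsob : ∫⁻ t in Set.Icc 0 T, sobolevNorm s (hF.mk F t) =
      ∫⁻ t in Set.Icc 0 T, sobolevNorm s (F t) := by
    refine lintegral_congr_ae ?_
    filter_upwards [hF.ae_eq_mk] with t ht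
    rw [ht]
  have hmax : ∀ k x, ∫⁻ t in Set.Icc 0 T, cellMax c k (hF.mk F t) x =
      ∫⁻ t in Set.Icc 0 T, cellMax c k (F t) x := fun k x => by
    refine lintegral_congr_ae ?_
    filter_upwards [hF.ae_eq_mk] with t ht
    rw [ht]
  refine lateralNorm_le_of_ae_le
    (M := fun x => ∑' k, ∫⁻ t in Set.Icc 0 T, cellMax c k (hF.mk F t) x)
    (Measurable.tsum fun k => ?_) hv ?_ ?_
  · have h1 := (measurable_cellMax c hF.stronglyMeasurable_mk k).comp measurable_swap
    exact h1.lintegral_prod_right'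
  · filter_upwards [ae_restrict_mem measurableSet_Icc] with t ht
    have hsub : Set.Ioc 0 t ⊆ Set.Icc 0 T := fun r hr => ⟨hr.1.le, hr.2.trans ht.2⟩
    have hFt : Integrable F (volume.restrict (Set.Ioc 0 t)) :=
      hFi.mono_measure (Measure.restrict_mono_set _ hsub)
    rw [intervalIntegral.integral_of_le ht.1]
    filter_upwards [ae_enorm_le_tsum_cellEval (fourier_integral_W1_eq_zero c hFt t)] with p hp
    refine hp.trans (ENNReal.tsum_le_tsum fun k => ?_)
    rw [hmax]
    exact (enorm_cellEval_integral_W1_le c hFt k t _ _).trans (lintegral_mono_set hsub)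
  · have h := lintegral_tsum_lintegral_cellMax_pow_le c hD hDs hF.stronglyMeasurable_mk
      (volume.restrict (Set.Icc 0 T))
    rwa [hsob] at h

lemma intervalIntegrable_W1 {s : ℝ} (hs : 0 ≤ s) {F : ℝ → L2Plane} {T : ℝ}
    (hF : AEStronglyMeasurable F (volume.restrict (Set.Icc 0 T)))
    (hFs : ∫⁻ t in Set.Icc 0 T, sobolevNorm s (F t) < ⊤) {t : ℝ} (ht : t ∈ Set.Icc 0 T) :
    IntervalIntegrable (fun t' => c.W1 (t - t') (F t')) volume 0 t := by
  rw [intervalIntegrable_iff_integrableOn_Ioc_of_le ht.1]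
  exact (integrable_W1 c (integrable_of_lintegral_sobolevNorm_lt_top hs hF hFs) t).mono_measure
    (Measure.restrict_mono_set _ fun r hr => ⟨hr.1.le, hr.2.trans ht.2⟩)

end Dysthe

theorem mainTheorem5 (α : ℕ → ℝ → ℂ) (hα : IsDyadicFamily α) (c : BasicCutoff) :
    (∃ C : ℝ, ∀ k j : ℕ, 7 ≤ k → j + 4 < k → ∀ t x y : ℝ, x ≠ 0 →
      ‖dyadicKernel α k j t x y‖ ≤
        C * |x| ^ (-(1 / 2 : ℝ)) * (2 : ℝ) ^ ((j : ℝ) + (k : ℝ) / 2)) ∧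
    (∀ s : ℝ, 3 / 4 < s → ∃ C : ℝ≥0, ∀ u₀ : L2Plane,
      (∃ u, Represents (Set.Ici 0) (fun t => c.W1 t u₀) u) ∧
      ∀ u, Represents (Set.Ici 0) (fun t => c.W1 t u₀) u →
        lateralNorm 4 ⊤ (Set.Ici 0) u ≤ C * sobolevNorm s u₀) ∧
    (∀ s : ℝ, 3 / 4 < s → ∃ C : ℝ≥0, ∀ (T : ℝ) (F : ℝ → L2Plane), 0 < T →
      AEStronglyMeasurable F (volume.restrict (Set.Icc 0 T)) →
      ∫⁻ t in Set.Icc 0 T, sobolevNorm s (F t) < ⊤ →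
      (∀ t ∈ Set.Icc 0 T, IntervalIntegrable (fun t' => c.W1 (t - t') (F t')) volume 0 t) ∧
      (∃ v, Represents (Set.Icc 0 T) (fun t => ∫ t' in (0 : ℝ)..t, c.W1 (t - t') (F t')) v) ∧
      ∀ v, Represents (Set.Icc 0 T) (fun t => ∫ t' in (0 : ℝ)..t, c.W1 (t - t') (F t')) v →
        lateralNorm 4 ⊤ (Set.Icc 0 T) v ≤ C * ∫⁻ t in Set.Icc 0 T, sobolevNorm s (F t)) := by
  refine ⟨Dysthe.exists_norm_dyadicKernel_le hα, fun s hs => ?_, fun s hs => ?_⟩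
  all_goals obtain ⟨D, hD, hDs⟩ := Dysthe.exists_tsum_cellBound_le hs
  · exact ⟨∑' k, D k, fun u₀ => ⟨Dysthe.exists_represents_W1 c u₀ _, fun u hu =>
      Dysthe.lateralNorm_W1_le c hD hDs u₀ hu⟩⟩
  · have hs0 : 0 ≤ s := by linarith
    exact ⟨∑' k, D k, fun T F _ hF hFs =>
      ⟨fun t ht => Dysthe.intervalIntegrable_W1 c hs0 hF hFs ht,
        Dysthe.exists_represents_duhamel c hF, fun v hv =>
        Dysthe.lateralNorm_duhamel_le c hs0 hD hDs hF hFs hv⟩⟩
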